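/- A Lie algebra $L$ over a field $\mathbb F$ is called zero product determined (zpd) if for every bilinear map $f:L\times L\to\mathbb F$ such that $f(x,y)=0$ whenever $x,y\in L$ and $[x,y]=0$, there exists a linear map $\Phi:[L,L]\to\mathbb F$ such that $f(x,y)=\Phi([x,y])$ for all $x,y\in L$; here $[L,L]$ is the linear span of all brackets. Let $\mathfrak{sl}_2$ be the Lie algebra of traceless complex $2\times 2$ matrices and let $V$ be a simple $\mathfrak{sl}_2$-module, of finite or infinite dimension over $\mathbb C$. Let $\mathfrak{sl}_2\ltimes V$ be the Galilei algebra, that is, the complex Lie algebra on the vector space $\mathfrak{sl}_2\oplus V$ with bracket $[x+u,\,y+v]=[x,y]+xv-yu$ for $x,y\in\mathfrak{sl}_2$ and $u,v\in V$. Then $\mathfrak{sl}_2\ltimes V$ is zpd if and only if $V$ is finite-dimensional and either $\dim V=2$ or $\dim V$ is odd. In particular, $\mathfrak{sl}_2\ltimes V$ is not zpd when $V$ is infinite-dimensional. -/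

import Mathlib

/-- A Lie algebra `L` over a field `F` is zero product determined if every bilinear form `f` on `L`
that vanishes on all commuting pairs is of the form `f x y = Φ ⁅x, y⁆` for a linear functional `Φ`
on the derived algebra `[L, L]` (the linear span of all brackets). -/
def IsZeroProductDetermined (F L : Type*) [Field F] [LieRing L] [LieAlgebra F L] : Prop :=
  ∀ f : L →ₗ[F] L →ₗ[F] F, (∀ x y : L, ⁅x, y⁆ = 0 → f x y = 0) →
    ∃ Φ : ↥⁅(⊤ : LieIdeal F L), (⊤ : LieIdeal F L)⁆ →ₗ[F] F,
      ∀ x y : L, f x y =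
        Φ ⟨⁅x, y⁆, LieSubmodule.lie_mem_lie (LieSubmodule.mem_top x) (LieSubmodule.mem_top y)⟩

/-- A copy of the vector space `V`, carrying the zero Lie bracket. -/
def AbelianLie (V : Type*) : Type _ := V

namespace AbelianLie

instance (V : Type*) [AddCommGroup V] : AddCommGroup (AbelianLie V) :=
  inferInstanceAs (AddCommGroup V)

instance (F V : Type*) [Field F] [AddCommGroup V] [Module F V] : Module F (AbelianLie V) :=
  inferInstanceAs (Module F V)

instance (V : Type*) [AddCommGroup V] : LieRing (AbelianLie V) where
  bracket _ _ := 0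
  add_lie _ _ _ := (add_zero 0).symm
  lie_add _ _ _ := (add_zero 0).symm
  lie_self _ := rfl
  leibniz_lie _ _ _ := (add_zero 0).symm

instance (F V : Type*) [Field F] [AddCommGroup V] [Module F V] : LieAlgebra F (AbelianLie V) where
  lie_smul t _ _ := (smul_zero t).symm

instance (V : Type*) [AddCommGroup V] : IsLieAbelian (AbelianLie V) where
  trivial _ _ := rfl

/-- The identity map from `V` to its copy with zero bracket. -/
def equiv (F V : Type*) [Field F] [AddCommGroup V] [Module F V] : V ≃ₗ[F] AbelianLie V :=
  LinearEquiv.refl F V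

end AbelianLie

/-- An `L`-module `V` as a Lie homomorphism from `L` to the derivations of `V` regarded as an
abelian Lie algebra (every linear endomorphism of `V` is such a derivation). -/
def LieModule.toAbelianDerivation (F L V : Type*) [Field F] [LieRing L] [LieAlgebra F L]
    [AddCommGroup V] [Module F V] [LieRingModule L V] [LieModule F L V] :
    L →ₗ⁅F⁆ LieDerivation F (AbelianLie V) (AbelianLie V) where
  toFun x :=
    { toLinearMap := (AbelianLie.equiv F V).conj (LieModule.toEnd F L V x)
      leibniz' := fun a b => by
        rw [trivial_lie_zero (AbelianLie V) (AbelianLie V) a b, map_zero,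
          trivial_lie_zero (AbelianLie V) (AbelianLie V) a,
          trivial_lie_zero (AbelianLie V) (AbelianLie V) b, sub_zero] }
  map_add' x y := by
    ext v
    exact add_lie x y ((AbelianLie.equiv F V).symm v)
  map_smul' t x := by
    ext v
    exact smul_lie t x ((AbelianLie.equiv F V).symm v)
  map_lie' {x y} := by
    ext v
    rw [LieDerivation.lie_apply]
    exact lie_lie x y ((AbelianLie.equiv F V).symm v)

/-- The semidirect product `L ⋉ V` of a Lie algebra `L` and an `L`-module `V`. -/
abbrev LieModule.SemidirectProduct (F L V : Type*) [Field F] [LieRing L] [LieAlgebra F L]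
    [AddCommGroup V] [Module F V] [LieRingModule L V] [LieModule F L V] : Type _ :=
  LieAlgebra.SemiDirectSum (AbelianLie V) L (LieModule.toAbelianDerivation F L V)

/-- The bracket of the semidirect product: `[x + u, y + v] = [x, y] + (x v - y u)`. -/
theorem LieModule.SemidirectProduct.lie_def (F L V : Type*) [Field F] [LieRing L] [LieAlgebra F L]
    [AddCommGroup V] [Module F V] [LieRingModule L V] [LieModule F L V] (x y : L) (u v : V) :
    ⁅(⟨AbelianLie.equiv F V u, x⟩ : LieModule.SemidirectProduct F L V),
      (⟨AbelianLie.equiv F V v, y⟩ : LieModule.SemidirectProduct F L V)⁆ =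
      ⟨AbelianLie.equiv F V (⁅x, v⁆ - ⁅y, u⁆), ⁅x, y⁆⟩ := by
  rw [LieAlgebra.SemiDirectSum.lie_eq_mk, map_sub]
  congr 1
  rw [trivial_lie_zero, zero_add]
  rfl

/-- The Lie algebra of traceless complex `2 × 2` matrices. -/
abbrev Sl2 : Type := ↥(LieAlgebra.SpecialLinear.sl (Fin 2) ℂ)

/-! Commuting elements of `sl₂` are proportional, alternating forms on `sl₂` factor through the
bracket, and `V` is an abelian ideal. So zpd means exactly that every bilinear `g` on `sl₂ × V`
vanishing whenever `x v = 0` has the form `ψ (x v)`.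

Infinite dimension. If the elements with nonzero kernel on `V` span `sl₂`, three of them form a
basis; by simplicity each acts locally finitely, and ordered monomials (PBW) show that a cyclic
vector generates a finite-dimensional space. Otherwise some functional `β ≠ 0` kills all of them;
testing the property on `β ⊗ ψ` for every `ψ` makes `ker β` act by scalars, so the perfect algebra
`sl₂` acts by zero.

Even dimension `n + 1 ≥ 4`. An element killing a nonzero vector must be nilpotent, since a
semisimple one needs the weight zero. Nilpotency is the equation `q ^ 2 + p * r = 0`, and it makes
an explicit `g`, built from the covector dual to the highest weight vector, admissible but not of
the form `ψ (x v)`.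

Dimension two or odd. Subtracting some `ψ (x v)` normalises `g`. The pairs with `x v = 0` are stable
under exponentials of nilpotent elements, so `g` kills every `z ^ k · (x ⊗ v)` with `z = e, f`. The
seed `e ⊗ v 0`, together with `h ⊗ v m` when `n = 2 m`, gives enough relations to force `g = 0`. -/

/-- The standard raising element of `sl₂`. -/
def sl2E : Sl2 := ⟨!![0, 1; 0, 0], by
  simp [LieAlgebra.SpecialLinear.sl, ← LieSubalgebra.mem_toSubmodule, Matrix.trace_fin_two]⟩

/-- The standard semisimple element of `sl₂`. -/
def sl2H : Sl2 := ⟨!![1, 0; 0, -1], by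
  simp [LieAlgebra.SpecialLinear.sl, ← LieSubalgebra.mem_toSubmodule, Matrix.trace_fin_two]⟩

/-- The standard lowering element of `sl₂`. -/
def sl2F : Sl2 := ⟨!![0, 0; 1, 0], by
  simp [LieAlgebra.SpecialLinear.sl, ← LieSubalgebra.mem_toSubmodule, Matrix.trace_fin_two]⟩

theorem Sl2.val_one_one (x : Sl2) : x.val 1 1 = -x.val 0 0 := by
  have h : Matrix.trace x.val = 0 := x.property
  rw [Matrix.trace_fin_two] at h
  linear_combination h

theorem Sl2.ext_entries {x y : Sl2} (h00 : x.val 0 0 = y.val 0 0) (h01 : x.val 0 1 = y.val 0 1)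
    (h10 : x.val 1 0 = y.val 1 0) : x = y := by
  apply Subtype.ext
  ext i j
  fin_cases i <;> fin_cases j
  · exact h00
  · exact h01
  · exact h10
  · exact (Sl2.val_one_one x).trans ((congrArg Neg.neg h00).trans (Sl2.val_one_one y).symm)

theorem Sl2.eq_combination (x : Sl2) :
    x = x.val 0 1 • sl2E + x.val 0 0 • sl2H + x.val 1 0 • sl2F := by
  apply Sl2.ext_entries <;> simp [sl2E, sl2H, sl2F]

theorem Sl2.lie_val_zero_zero (x y : Sl2) :
    (⁅x, y⁆ : Sl2).val 0 0 = x.val 0 1 * y.val 1 0 - x.val 1 0 * y.val 0 1 := by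
  rw [LieAlgebra.SpecialLinear.sl_bracket]
  simp only [Matrix.sub_apply, Matrix.mul_apply, Fin.sum_univ_two]
  ring

theorem Sl2.lie_val_zero_one (x y : Sl2) :
    (⁅x, y⁆ : Sl2).val 0 1 = 2 * (x.val 0 0 * y.val 0 1 - x.val 0 1 * y.val 0 0) := by
  rw [LieAlgebra.SpecialLinear.sl_bracket]
  simp only [Matrix.sub_apply, Matrix.mul_apply, Fin.sum_univ_two, Sl2.val_one_one]
  ring

theorem Sl2.lie_val_one_zero (x y : Sl2) :
    (⁅x, y⁆ : Sl2).val 1 0 = 2 * (x.val 1 0 * y.val 0 0 - x.val 0 0 * y.val 1 0) := by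
  rw [LieAlgebra.SpecialLinear.sl_bracket]
  simp only [Matrix.sub_apply, Matrix.mul_apply, Fin.sum_univ_two, Sl2.val_one_one]
  ring

theorem sl2_lie_H_E : ⁅sl2H, sl2E⁆ = (2 : ℂ) • sl2E := by
  apply Sl2.ext_entries
  · rw [Sl2.lie_val_zero_zero]; simp [sl2E, sl2H]
  · rw [Sl2.lie_val_zero_one]; simp [sl2E, sl2H]
  · rw [Sl2.lie_val_one_zero]; simp [sl2E, sl2H]

theorem sl2_lie_H_F : ⁅sl2H, sl2F⁆ = -((2 : ℂ) • sl2F) := by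
  apply Sl2.ext_entries
  · rw [Sl2.lie_val_zero_zero]; simp [sl2F, sl2H]
  · rw [Sl2.lie_val_zero_one]; simp [sl2F, sl2H]
  · rw [Sl2.lie_val_one_zero]; simp [sl2F, sl2H]

theorem sl2_lie_E_F : ⁅sl2E, sl2F⁆ = sl2H := by
  apply Sl2.ext_entries
  · rw [Sl2.lie_val_zero_zero]; simp [sl2F, sl2E, sl2H]
  · rw [Sl2.lie_val_zero_one]; simp [sl2F, sl2E, sl2H]
  · rw [Sl2.lie_val_one_zero]; simp [sl2F, sl2E, sl2H]

theorem sl2H_ne_zero : sl2H ≠ 0 := fun h => by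
  have := congrArg (fun x : Sl2 => x.val 0 0) h
  simp [sl2H] at this

theorem isSl2Triple_standard : IsSl2Triple sl2H sl2E sl2F where
  h_ne_zero := sl2H_ne_zero
  lie_e_f := sl2_lie_E_F
  lie_h_e_nsmul := by rw [sl2_lie_H_E, ofNat_smul_eq_nsmul]
  lie_h_f_nsmul := by rw [sl2_lie_H_F, ofNat_smul_eq_nsmul]

/-- Commuting elements of `sl₂` are proportional. -/
theorem Sl2.exists_smul_of_lie_eq_zero {x y : Sl2} (hx : x ≠ 0) (h : ⁅x, y⁆ = 0) :
    ∃ c : ℂ, y = c • x := by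
  have h00 := (Sl2.lie_val_zero_zero x y).symm.trans (by rw [h]; rfl : _ = (0 : ℂ))
  have h01 := (Sl2.lie_val_zero_one x y).symm.trans (by rw [h]; rfl : _ = (0 : ℂ))
  have h10 := (Sl2.lie_val_one_zero x y).symm.trans (by rw [h]; rfl : _ = (0 : ℂ))
  by_cases ha : x.val 0 0 = 0
  · by_cases hb : x.val 0 1 = 0
    · have hc : x.val 1 0 ≠ 0 := fun hc => hx (Sl2.ext_entries ha hb hc)
      refine ⟨y.val 1 0 / x.val 1 0, Sl2.ext_entries ?_ ?_ ?_⟩ <;> simp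
      · field_simp; linear_combination (1 / 2) * h10
      · field_simp; linear_combination -h00
      · field_simp
    · refine ⟨y.val 0 1 / x.val 0 1, Sl2.ext_entries ?_ ?_ ?_⟩ <;> simp
      · field_simp; linear_combination (-1 / 2) * h01
      · field_simp
      · field_simp; linear_combination h00
  · refine ⟨y.val 0 0 / x.val 0 0, Sl2.ext_entries ?_ ?_ ?_⟩ <;> simp
    · field_simp
    · field_simp; linear_combination (1 / 2) * h01
    · field_simp; linear_combination (-1 / 2) * h10

/-- An entry of a traceless matrix, as a linear functional. -/
def Sl2.entry (i j : Fin 2) : Sl2 →ₗ[ℂ] ℂ where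
  toFun x := x.val i j
  map_add' _ _ := rfl
  map_smul' _ _ := rfl

theorem Sl2.entry_apply (i j : Fin 2) (x : Sl2) : Sl2.entry i j x = x.val i j := rfl

/-- Every alternating bilinear form on `sl₂` is a linear functional of the bracket. -/
theorem Sl2.exists_eq_comp_lie (f : Sl2 →ₗ[ℂ] Sl2 →ₗ[ℂ] ℂ) (hf : ∀ x, f x x = 0) :
    ∃ φ : Sl2 →ₗ[ℂ] ℂ, ∀ x y, f x y = φ ⁅x, y⁆ := by
  have skew : ∀ x y, f y x = -f x y := fun x y => by
    have := hf (x + y)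
    simp only [map_add, LinearMap.add_apply, hf, zero_add, add_zero] at this
    linear_combination this
  -- The coefficients are forced by `[e, f] = h`, `[h, e] = 2 e`, `[h, f] = -2 f`.
  refine ⟨f sl2E sl2F • Sl2.entry 0 0 + (f sl2H sl2E / 2) • Sl2.entry 0 1 +
    (-(f sl2H sl2F / 2)) • Sl2.entry 1 0, fun x y => ?_⟩
  conv_lhs => rw [Sl2.eq_combination x, Sl2.eq_combination y]
  simp only [map_add, map_smul, LinearMap.add_apply, LinearMap.smul_apply, hf, smul_eq_mul,
    skew sl2H sl2E, skew sl2H sl2F, skew sl2E sl2F, Sl2.entry_apply, Sl2.lie_val_zero_zero,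
    Sl2.lie_val_zero_one, Sl2.lie_val_one_zero]
  ring

/-! ### Reduction to bilinear maps on `sl₂ × V` -/

/-- Every bilinear map on `L × V` vanishing on the pairs with `x v = 0` is a linear functional of
the action `x v`. -/
def LieModule.IsActionDetermined (F L V : Type*) [Field F] [LieRing L] [LieAlgebra F L]
    [AddCommGroup V] [Module F V] [LieRingModule L V] : Prop :=
  ∀ g : L →ₗ[F] V →ₗ[F] F, (∀ (x : L) (v : V), ⁅x, v⁆ = 0 → g x v = 0) →
    ∃ ψ : V →ₗ[F] F, ∀ (x : L) (v : V), g x v = ψ ⁅x, v⁆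

section Reduction

variable {V : Type*} [AddCommGroup V] [Module ℂ V] [LieRingModule Sl2 V] [LieModule ℂ Sl2 V]

theorem LieModule.SemidirectProduct.exists_pair (z : LieModule.SemidirectProduct ℂ Sl2 V) :
    ∃ (x : Sl2) (u : V), z = ⟨AbelianLie.equiv ℂ V u, x⟩ := ⟨z.right, z.left, rfl⟩

/-- The alternating form `g x v - g y u` tests `g`: if `x + u` and `y + v` commute with `x ≠ 0`,
then `y = c x` and `x (v - c u) = 0`, and the form equals `g x (v - c u)`. -/
theorem LieModule.SemidirectProduct.isActionDetermined
    (h : IsZeroProductDetermined ℂ (LieModule.SemidirectProduct ℂ Sl2 V)) :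
    LieModule.IsActionDetermined ℂ Sl2 V := by
  intro g hg
  let pl : LieModule.SemidirectProduct ℂ Sl2 V →ₗ[ℂ] V :=
    (AbelianLie.equiv ℂ V).symm.toLinearMap ∘ₗ
      LieAlgebra.SemiDirectSum.projl (LieModule.toAbelianDerivation ℂ Sl2 V)
  let pr : LieModule.SemidirectProduct ℂ Sl2 V →ₗ[ℂ] Sl2 :=
    (LieAlgebra.SemiDirectSum.projr (LieModule.toAbelianDerivation ℂ Sl2 V)).toLinearMap
  let f := g.compl₁₂ pr pl - (g.compl₁₂ pr pl).flip
  have hf : ∀ (x y : Sl2) (u v : V), f ⟨AbelianLie.equiv ℂ V u, x⟩ ⟨AbelianLie.equiv ℂ V v, y⟩ =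
    g x v - g y u := fun _ _ _ _ => rfl
  obtain ⟨Φ, hΦ⟩ := h f (by
    intro z w hzw
    obtain ⟨x, u, rfl⟩ := LieModule.SemidirectProduct.exists_pair z
    obtain ⟨y, v, rfl⟩ := LieModule.SemidirectProduct.exists_pair w
    rw [LieModule.SemidirectProduct.lie_def] at hzw
    have h1 : ⁅x, v⁆ - ⁅y, u⁆ = 0 := congrArg LieAlgebra.SemiDirectSum.left hzw
    have h2 : ⁅x, y⁆ = 0 := congrArg LieAlgebra.SemiDirectSum.right hzw
    rw [hf]
    by_cases hx : x = 0
    · subst hx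
      rw [zero_lie, zero_sub, neg_eq_zero] at h1
      rw [hg y u h1, map_zero, LinearMap.zero_apply, sub_zero]
    · obtain ⟨c, rfl⟩ := Sl2.exists_smul_of_lie_eq_zero hx h2
      have := hg x (v - c • u) (by rw [lie_sub, lie_smul, ← smul_lie, h1])
      rwa [map_sub, map_smul, ← LinearMap.smul_apply, ← map_smul] at this)
  -- `Φ` lives only on the derived algebra; any linear extension restricts to a functional on `V`.
  obtain ⟨Ψ, hΨ⟩ := LinearMap.exists_extend Φ
  refine ⟨Ψ ∘ₗ (LieAlgebra.SemiDirectSum.inl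
    (LieModule.toAbelianDerivation ℂ Sl2 V)).toLinearMap ∘ₗ (AbelianLie.equiv ℂ V).toLinearMap,
    fun x v => ?_⟩
  have h1 := hΦ ⟨AbelianLie.equiv ℂ V 0, x⟩ ⟨AbelianLie.equiv ℂ V v, 0⟩
  rw [hf, map_zero, sub_zero, ← hΨ] at h1
  rw [h1]
  change Ψ _ = Ψ _
  congr 1
  change ⁅(⟨AbelianLie.equiv ℂ V 0, x⟩ : LieModule.SemidirectProduct ℂ Sl2 V),
    (⟨AbelianLie.equiv ℂ V v, 0⟩ : LieModule.SemidirectProduct ℂ Sl2 V)⁆ = _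
  rw [LieModule.SemidirectProduct.lie_def ℂ Sl2 V x 0 0 v, lie_zero, lie_zero, sub_zero]
  rfl

/-- Such a form is alternating and vanishes on `V × V`, so it is determined by its `sl₂ × sl₂` and
`sl₂ × V` blocks, each of which factors through the bracket. -/
theorem LieModule.IsActionDetermined.isZeroProductDetermined
    (h : LieModule.IsActionDetermined ℂ Sl2 V) :
    IsZeroProductDetermined ℂ (LieModule.SemidirectProduct ℂ Sl2 V) := by
  intro f hf
  let il : V →ₗ[ℂ] LieModule.SemidirectProduct ℂ Sl2 V :=
    (LieAlgebra.SemiDirectSum.inl (LieModule.toAbelianDerivation ℂ Sl2 V)).toLinearMap ∘ₗ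
      (AbelianLie.equiv ℂ V).toLinearMap
  let ir : Sl2 →ₗ[ℂ] LieModule.SemidirectProduct ℂ Sl2 V :=
    (LieAlgebra.SemiDirectSum.inr (LieModule.toAbelianDerivation ℂ Sl2 V)).toLinearMap
  let pl : LieModule.SemidirectProduct ℂ Sl2 V →ₗ[ℂ] V :=
    (AbelianLie.equiv ℂ V).symm.toLinearMap ∘ₗ
      LieAlgebra.SemiDirectSum.projl (LieModule.toAbelianDerivation ℂ Sl2 V)
  let pr : LieModule.SemidirectProduct ℂ Sl2 V →ₗ[ℂ] Sl2 :=
    (LieAlgebra.SemiDirectSum.projr (LieModule.toAbelianDerivation ℂ Sl2 V)).toLinearMap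
  have hil : ∀ u, il u = ⟨AbelianLie.equiv ℂ V u, 0⟩ := fun _ => rfl
  have hir : ∀ x, ir x = ⟨AbelianLie.equiv ℂ V 0, x⟩ := fun _ => rfl
  have hdec : ∀ z, z = ir (pr z) + il (pl z) := fun z => by
    obtain ⟨x, u, rfl⟩ := LieModule.SemidirectProduct.exists_pair z
    rw [hir, hil, map_zero, LieAlgebra.SemiDirectSum.add_eq_mk, zero_add]
    exact congrArg _ (add_zero x).symm
  have alt : ∀ z, f z z = 0 := fun z => hf z z (lie_self z)
  have skew : ∀ z w, f w z = -f z w := fun z w => by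
    have := alt (z + w)
    simp only [map_add, LinearMap.add_apply, alt, zero_add, add_zero] at this
    linear_combination this
  have huv : ∀ u v, f (il u) (il v) = 0 := fun u v => hf _ _ (by
    rw [hil, hil, LieModule.SemidirectProduct.lie_def, zero_lie, zero_lie, sub_zero, zero_lie,
      map_zero]; rfl)
  obtain ⟨ψ, hψ⟩ := h (f.compl₁₂ ir il) (fun x v hxv => hf _ _ (by
    rw [hil, hir, LieModule.SemidirectProduct.lie_def, hxv, lie_zero, sub_zero, lie_zero,
      map_zero]; rfl))
  obtain ⟨φ, hφ⟩ := Sl2.exists_eq_comp_lie (f.compl₁₂ ir ir) (fun x => alt _)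
  refine ⟨(φ ∘ₗ pr + ψ ∘ₗ pl) ∘ₗ (LieSubmodule.toSubmodule _).subtype, fun z w => ?_⟩
  have hψ' : ∀ x v, f (ir x) (il v) = ψ ⁅x, v⁆ := hψ
  have hφ' : ∀ x y, f (ir x) (ir y) = φ ⁅x, y⁆ := hφ
  have hlhs : f z w = φ ⁅pr z, pr w⁆ + ψ (⁅pr z, pl w⁆ - ⁅pr w, pl z⁆) := by
    conv_lhs => rw [hdec z, hdec w]
    simp only [map_add, LinearMap.add_apply, huv, hψ', hφ', skew (ir (pr w)) (il (pl z)), map_sub]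
    ring
  rw [hlhs]
  obtain ⟨x, u, rfl⟩ := LieModule.SemidirectProduct.exists_pair z
  obtain ⟨y, v, rfl⟩ := LieModule.SemidirectProduct.exists_pair w
  change _ = (φ ∘ₗ pr + ψ ∘ₗ pl)
    ⁅(⟨AbelianLie.equiv ℂ V u, x⟩ : LieModule.SemidirectProduct ℂ Sl2 V),
      (⟨AbelianLie.equiv ℂ V v, y⟩ : LieModule.SemidirectProduct ℂ Sl2 V)⁆
  rw [LieModule.SemidirectProduct.lie_def]
  rfl

end Reduction

/-! ### Local finiteness and ordered monomials -/

section LocallyFinite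

theorem LieModule.eq_top_of_mem {L V : Type*} [LieRing L] [AddCommGroup V] [Module ℂ V]
    [LieRingModule L V] [LieModule.IsIrreducible ℂ L V] (N : LieSubmodule ℂ L V) {v : V}
    (hv : v ∈ N) (hv0 : v ≠ 0) : N = ⊤ := by
  rcases IsSimpleOrder.eq_bot_or_eq_top N with h | h
  · rw [h, LieSubmodule.mem_bot] at hv
    exact absurd hv hv0
  · exact h

variable {L V : Type*} [LieRing L] [LieAlgebra ℂ L] [AddCommGroup V] [Module ℂ V]
  [LieRingModule L V] [LieModule ℂ L V]

/-- The action of `L` on `V` as a bilinear map. -/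
def LieModule.action (L V : Type*) [LieRing L] [LieAlgebra ℂ L] [AddCommGroup V] [Module ℂ V]
    [LieRingModule L V] [LieModule ℂ L V] : L →ₗ[ℂ] Module.End ℂ V :=
  LinearMap.mk₂ ℂ (fun x v => ⁅x, v⁆) add_lie smul_lie lie_add fun c x v => lie_smul c x v

/-- The vectors contained in a finite-dimensional subspace stable under `x`. -/
def LieModule.locallyFinite [FiniteDimensional ℂ L] (x : L) : LieSubmodule ℂ L V where
  carrier := {v | ∃ W : Submodule ℂ V, FiniteDimensional ℂ W ∧ v ∈ W ∧ ∀ w ∈ W, ⁅x, w⁆ ∈ W}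
  zero_mem' := ⟨⊥, inferInstance, Submodule.zero_mem _, fun w hw => by
    rw [Submodule.mem_bot] at hw ⊢
    rw [hw, lie_zero]⟩
  add_mem' := by
    rintro u v ⟨W, hW, hu, hxW⟩ ⟨W', hW', hv, hxW'⟩
    refine ⟨W ⊔ W', inferInstance, Submodule.add_mem_sup hu hv, fun w hw => ?_⟩
    obtain ⟨a, ha, b, hb, rfl⟩ := Submodule.mem_sup.1 hw
    rw [lie_add]
    exact Submodule.add_mem_sup (hxW a ha) (hxW' b hb)
  smul_mem' := by
    rintro c v ⟨W, hW, hv, hxW⟩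
    exact ⟨W, hW, W.smul_mem c hv, hxW⟩
  lie_mem := by
    rintro y v ⟨W, hW, hv, hxW⟩
    -- `L · W` is finite-dimensional, and stable since `x (a w) = [x, a] w + a (x w)`.
    let T := Submodule.map₂ (LieModule.action L V) ⊤ W
    have hT : T ≤ T.comap (LieModule.action L V x) := Submodule.map₂_le.2 fun a _ b hb => by
      change ⁅x, ⁅a, b⁆⁆ ∈ T
      rw [leibniz_lie]
      exact Submodule.add_mem _ (Submodule.apply_mem_map₂ (LieModule.action L V)
        (Submodule.mem_top (x := ⁅x, a⁆)) hb)
        (Submodule.apply_mem_map₂ (LieModule.action L V)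
        (Submodule.mem_top (x := a)) (hxW b hb))
    exact ⟨T, Module.Finite.iff_fg.2 ((Module.finite_def.1 ‹_›).map₂ _ (Module.Finite.iff_fg.1 hW)),
      Submodule.apply_mem_map₂ _ Submodule.mem_top hv, hT⟩

/-- A killed vector spans a stable line, so the submodule of `x`-locally finite vectors is nonzero,
hence everything. Stable spaces for a basis of `U` are then added up. -/
theorem LieModule.exists_stable_of_lie_eq_zero [FiniteDimensional ℂ L]
    [LieModule.IsIrreducible ℂ L V] {x : L} {v : V} (hv0 : v ≠ 0) (hv : ⁅x, v⁆ = 0)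
    (U : Submodule ℂ V) [FiniteDimensional ℂ U] :
    ∃ W : Submodule ℂ V, FiniteDimensional ℂ W ∧ U ≤ W ∧ ∀ w ∈ W, ⁅x, w⁆ ∈ W := by
  have htop : (LieModule.locallyFinite x : LieSubmodule ℂ L V) = ⊤ :=
    LieModule.eq_top_of_mem _ (v := v) ⟨ℂ ∙ v, inferInstance, Submodule.mem_span_singleton_self v,
      fun w hw => by
        obtain ⟨c, rfl⟩ := Submodule.mem_span_singleton.1 hw
        rw [lie_smul, hv, smul_zero]
        exact Submodule.zero_mem _⟩ hv0
  have hmem : ∀ u : V, ∃ W : Submodule ℂ V, FiniteDimensional ℂ W ∧ u ∈ W ∧ ∀ w ∈ W, ⁅x, w⁆ ∈ W :=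
    fun u => (htop ▸ LieSubmodule.mem_top u : u ∈ (LieModule.locallyFinite x : LieSubmodule ℂ L V))
  choose W hW hu hxW using hmem
  let b := Module.finBasis ℂ U
  refine ⟨⨆ i, W (b i), inferInstance, ?_, fun w hw => ?_⟩
  · intro u hu'
    have := b.sum_repr ⟨u, hu'⟩
    have h2 := congrArg U.subtype this
    simp only [map_sum, map_smul, Submodule.subtype_apply] at h2
    rw [← h2]
    exact Submodule.sum_mem _ fun i _ => Submodule.smul_mem _ _
      (Submodule.mem_iSup_of_mem i (hu _))
  · induction hw using Submodule.iSup_induction' with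
    | mem i w hw => exact Submodule.mem_iSup_of_mem i (hxW _ w hw)
    | zero => rw [lie_zero]; exact Submodule.zero_mem _
    | add a b _ _ ha hb => rw [lie_add]; exact Submodule.add_mem _ ha hb

/-- Commuting past an element of `S` does not raise the degree. -/
theorem Submodule.mul_sub_mul_mem_pow {A : Type*} [Ring A] [Algebra ℂ A] (S : Submodule ℂ A)
    (hS : ∀ a ∈ S, ∀ b ∈ S, a * b - b * a ∈ S) (n : ℕ) :
    ∀ s ∈ S ^ n, ∀ a ∈ S, s * a - a * s ∈ S ^ n := by
  induction n with
  | zero =>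
    intro s hs a _
    rw [pow_zero, Submodule.mem_one] at hs
    obtain ⟨c, rfl⟩ := hs
    rw [Algebra.commutes, sub_self]
    exact Submodule.zero_mem _
  | succ n ih =>
    intro s hs a ha
    rw [pow_succ] at hs ⊢
    induction hs using Submodule.mul_induction_on' with
    | mem_mul_mem s hs b hb =>
      have : s * b * a - a * (s * b) = s * (b * a - a * b) + (s * a - a * s) * b := by noncomm_ring
      rw [this]
      exact Submodule.add_mem _ (Submodule.mul_mem_mul hs (hS b hb a ha))
        (Submodule.mul_mem_mul (ih s hs a ha) hb)
    | add s _ t _ h1 h2 =>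
      have : (s + t) * a - a * (s + t) = (s * a - a * s) + (t * a - a * t) := by noncomm_ring
      rw [this]
      exact Submodule.add_mem _ h1 h2

theorem Submodule.pow_mono_of_one_mem {A : Type*} [Ring A] [Algebra ℂ A] {S : Submodule ℂ A}
    (h1 : 1 ∈ S) : Monotone fun n : ℕ => S ^ n := fun _ _ hab =>
  pow_le_pow_right₀ (Submodule.one_le.2 h1) hab

theorem Submodule.mul_mem_pow_succ {A : Type*} [Ring A] [Algebra ℂ A] {S : Submodule ℂ A}
    {a s : A} {n : ℕ} (ha : a ∈ S) (hs : s ∈ S ^ n) : a * s ∈ S ^ (n + 1) := by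
  rw [pow_succ']
  exact Submodule.mul_mem_mul ha hs

theorem Submodule.one_mem_pow_one {A : Type*} [Ring A] [Algebra ℂ A] {S : Submodule ℂ A}
    (h1 : 1 ∈ S) : 1 ∈ S ^ 1 := by
  rwa [pow_one]

/-- The spanning half of the Poincaré–Birkhoff–Witt theorem for three generators. -/
theorem Submodule.pow_le_span_ordered_monomials {A : Type*} [Ring A] [Algebra ℂ A] (x y z : A)
    (hS : ∀ a ∈ Submodule.span ℂ {1, x, y, z}, ∀ b ∈ Submodule.span ℂ {1, x, y, z},
      a * b - b * a ∈ Submodule.span ℂ {1, x, y, z}) (n : ℕ) :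
    Submodule.span ℂ {1, x, y, z} ^ n ≤
      Submodule.span ℂ {a | ∃ i j k : ℕ, i + j + k ≤ n ∧ a = x ^ i * y ^ j * z ^ k} := by
  set S := Submodule.span ℂ {1, x, y, z} with hSdef
  have h1 : (1 : A) ∈ S := Submodule.subset_span (by simp)
  have hx : x ∈ S := Submodule.subset_span (by simp)
  have hy : y ∈ S := Submodule.subset_span (by simp)
  have hz : z ∈ S := Submodule.subset_span (by simp)
  have mono := Submodule.pow_mono_of_one_mem h1
  induction n with
  | zero =>
    rw [pow_zero, Submodule.one_eq_span, Submodule.span_le]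
    rintro _ rfl
    exact Submodule.subset_span ⟨0, 0, 0, le_rfl, by simp⟩
  | succ n ih =>
    set P : ℕ → Submodule ℂ A := fun n =>
      Submodule.span ℂ {a | ∃ i j k : ℕ, i + j + k ≤ n ∧ a = x ^ i * y ^ j * z ^ k} with hP
    have hPmem : ∀ m i j k : ℕ, i + j + k ≤ m → x ^ i * y ^ j * z ^ k ∈ P m := fun m i j k h =>
      Submodule.subset_span ⟨i, j, k, h, rfl⟩
    have hPle : P n ≤ P (n + 1) := Submodule.span_mono fun a ⟨i, j, k, h, e⟩ =>
      ⟨i, j, k, h.trans n.le_succ, e⟩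
    refine (mul_le_mul_left ih S : S ^ n * S ≤ P n * S).trans ?_
    change Submodule.span ℂ _ * Submodule.span ℂ _ ≤ _
    rw [Submodule.span_mul_span, Submodule.span_le]
    rintro _ ⟨_, ⟨i, j, k, hijk, rfl⟩, b, hb, rfl⟩
    have hxi := Submodule.pow_mem_pow S hx i
    have hyj := Submodule.pow_mem_pow S hy j
    have hzk := Submodule.pow_mem_pow S hz k
    have key : ∀ c : A, c ∈ S ^ (i + j + k) → c ∈ P (n + 1) := fun c hc =>
      hPle (ih (mono hijk hc))
    change x ^ i * y ^ j * z ^ k * b ∈ P (n + 1)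
    rcases hb with rfl | rfl | rfl | rfl
    · rw [mul_one]
      exact hPmem _ _ _ _ (by omega)
    -- Moving the new factor into its place costs a commutator term in `S ^ (i + j + k)`, which the
    -- induction hypothesis covers.
    · have e : b ^ i * y ^ j * z ^ k * b = b ^ (i + 1) * y ^ j * z ^ k +
          b ^ i * (y ^ j * z ^ k * b - b * (y ^ j * z ^ k)) := by
        rw [pow_succ]; noncomm_ring
      rw [e]
      refine Submodule.add_mem _ (hPmem _ _ _ _ (by omega)) (key _ ?_)
      rw [add_assoc, pow_add]
      refine Submodule.mul_mem_mul hxi (Submodule.mul_sub_mul_mem_pow S hS _ _ ?_ _ hx)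
      rw [pow_add]
      exact Submodule.mul_mem_mul hyj hzk
    · have e : x ^ i * b ^ j * z ^ k * b = x ^ i * b ^ (j + 1) * z ^ k +
          x ^ i * b ^ j * (z ^ k * b - b * z ^ k) := by
        rw [pow_succ]; noncomm_ring
      rw [e]
      refine Submodule.add_mem _ (hPmem _ _ _ _ (by omega)) (key _ ?_)
      rw [pow_add, pow_add]
      exact Submodule.mul_mem_mul (Submodule.mul_mem_mul hxi hyj)
        (Submodule.mul_sub_mul_mem_pow S hS _ _ hzk _ hy)
    · rw [mul_assoc, ← pow_succ]
      exact hPmem _ _ _ _ (by omega)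

/-- An irreducible module on which three elements spanning `L` have nonzero kernels is
finite-dimensional. -/
theorem LieModule.finiteDimensional_of_exists_lie_eq_zero [FiniteDimensional ℂ L]
    [LieModule.IsIrreducible ℂ L V] {x y z : L}
    (hspan : Submodule.span ℂ {x, y, z} = ⊤)
    (hx : ∃ v : V, v ≠ 0 ∧ ⁅x, v⁆ = 0) (hy : ∃ v : V, v ≠ 0 ∧ ⁅y, v⁆ = 0)
    (hz : ∃ v : V, v ≠ 0 ∧ ⁅z, v⁆ = 0) : FiniteDimensional ℂ V := by
  obtain ⟨v, hv, hxv⟩ := hx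
  obtain ⟨v', hv', hyv⟩ := hy
  obtain ⟨v'', hv'', hzv⟩ := hz
  -- The nesting matches the order of the monomials: `z ^ k v ∈ W₁`, then `y ^ j` keeps it in `W₂`
  -- and `x ^ i` in `W₃`.
  obtain ⟨W₁, _, hW₁, hzW⟩ := LieModule.exists_stable_of_lie_eq_zero hv'' hzv (ℂ ∙ v)
  obtain ⟨W₂, _, hW₂, hyW⟩ := LieModule.exists_stable_of_lie_eq_zero hv' hyv W₁
  obtain ⟨W₃, _, hW₃, hxW⟩ := LieModule.exists_stable_of_lie_eq_zero hv hxv W₂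
  have iter : ∀ (a : L) (W : Submodule ℂ V), (∀ w ∈ W, ⁅a, w⁆ ∈ W) → ∀ (i : ℕ), ∀ w ∈ W,
      (LieModule.action L V a ^ i) w ∈ W := fun a W hW i w hw => by
    induction i with
    | zero => exact hw
    | succ i ih => rw [pow_succ']; exact hW _ ih
  let ρ := LieModule.action L V
  let S : Submodule ℂ (Module.End ℂ V) := Submodule.span ℂ {1, ρ x, ρ y, ρ z}
  have hρ : ∀ a, ρ a ∈ S := fun a => by
    have ha : a ∈ Submodule.span ℂ {x, y, z} := hspan ▸ Submodule.mem_top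
    obtain ⟨c₁, c₂, c₃, rfl⟩ := Submodule.mem_span_triple.1 ha
    simp only [map_add, map_smul]
    exact Submodule.add_mem _ (Submodule.add_mem _
      (Submodule.smul_mem _ _ (Submodule.subset_span (by simp)))
      (Submodule.smul_mem _ _ (Submodule.subset_span (by simp))))
      (Submodule.smul_mem _ _ (Submodule.subset_span (by simp)))
  have hSform : ∀ s ∈ S, ∃ (c : ℂ) (a : L), s = c • 1 + ρ a := fun s hs => by
    obtain ⟨c, t, ht, rfl⟩ := Submodule.mem_span_insert.1 hs
    obtain ⟨c₁, c₂, c₃, rfl⟩ := Submodule.mem_span_triple.1 ht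
    exact ⟨c, c₁ • x + c₂ • y + c₃ • z, by simp only [map_add, map_smul]⟩
  have hS : ∀ a ∈ S, ∀ b ∈ S, a * b - b * a ∈ S := fun s hs t ht => by
    obtain ⟨c, a, rfl⟩ := hSform s hs
    obtain ⟨d, b, rfl⟩ := hSform t ht
    have : (c • 1 + ρ a) * (d • 1 + ρ b) - (d • 1 + ρ b) * (c • 1 + ρ a) = ρ ⁅a, b⁆ := by
      ext v
      have hρ' : ∀ a v, ρ a v = ⁅a, v⁆ := fun _ _ => rfl
      simp only [LinearMap.sub_apply, Module.End.mul_apply, LinearMap.add_apply,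
        LinearMap.smul_apply, Module.End.one_apply, hρ', lie_lie, lie_add, lie_smul]
      module
    rw [this]
    exact hρ _
  have h1S : (1 : Module.End ℂ V) ∈ S := Submodule.subset_span (by simp)
  have hmem : ∀ n, ∀ s ∈ S ^ n, s v ∈ W₃ := fun n s hs => by
    have := Submodule.pow_le_span_ordered_monomials (ρ x) (ρ y) (ρ z) hS n hs
    clear hs
    induction this using Submodule.span_induction with
    | mem s h =>
      obtain ⟨i, j, k, -, rfl⟩ := h
      exact iter x W₃ hxW i _ (hW₃ (iter y W₂ hyW j _ (hW₂ (iter z W₁ hzW k _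
        (hW₁ (Submodule.mem_span_singleton_self v))))))
    | zero => exact W₃.zero_mem
    | add s t _ _ h1 h2 => exact W₃.add_mem h1 h2
    | smul c s _ h1 => exact W₃.smul_mem c h1
  have mono := Submodule.pow_mono_of_one_mem h1S
  -- The submodule generated by `v`, as the union of the spaces `S ^ n v`.
  let N : LieSubmodule ℂ L V :=
    { carrier := {w | ∃ n : ℕ, ∃ s ∈ S ^ n, s v = w}
      zero_mem' := ⟨0, 0, Submodule.zero_mem _, rfl⟩
      add_mem' := by
        rintro _ _ ⟨n, s, hs, rfl⟩ ⟨m, t, ht, rfl⟩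
        exact ⟨max n m, s + t, Submodule.add_mem _ (mono (le_max_left n m) hs)
          (mono (le_max_right n m) ht), rfl⟩
      smul_mem' := by
        rintro c _ ⟨n, s, hs, rfl⟩
        exact ⟨n, c • s, Submodule.smul_mem _ c hs, rfl⟩
      lie_mem := by
        rintro a _ ⟨n, s, hs, rfl⟩
        refine ⟨n + 1, ρ a * s, ?_, rfl⟩
        exact Submodule.mul_mem_pow_succ (hρ a) hs }
  have hN : N = ⊤ := LieModule.eq_top_of_mem N (v := v)
    ⟨1, 1, Submodule.one_mem_pow_one h1S, rfl⟩ hv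
  have hW : W₃ = ⊤ := by
    rw [eq_top_iff]
    intro w _
    obtain ⟨n, s, hs, rfl⟩ : w ∈ N := hN ▸ LieSubmodule.mem_top w
    exact hmem n s hs
  subst hW
  exact Module.Finite.of_surjective (⊤ : Submodule ℂ V).subtype fun w => ⟨⟨w, trivial⟩, rfl⟩

end LocallyFinite

/-! ### The property forces finite dimension -/

section Determined

theorem LieModule.finiteDimensional_of_isTrivial {V : Type*} [AddCommGroup V]
    [Module ℂ V] [LieRingModule Sl2 V] [LieModule.IsIrreducible ℂ Sl2 V]
    (h : ∀ (x : Sl2) (v : V), ⁅x, v⁆ = 0) : FiniteDimensional ℂ V := by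
  have := LieModule.nontrivial_of_isIrreducible ℂ Sl2 V
  obtain ⟨v, hv⟩ := exists_ne (0 : V)
  let N : LieSubmodule ℂ Sl2 V :=
    { (ℂ ∙ v) with
      lie_mem := fun {x m} _ => by
        rw [h]
        exact Submodule.zero_mem (ℂ ∙ v) }
  have hN : N = ⊤ := LieModule.eq_top_of_mem N (Submodule.mem_span_singleton_self v) hv
  have hW : (ℂ ∙ v) = ⊤ := by
    rw [eq_top_iff]
    intro w _
    exact (hN ▸ LieSubmodule.mem_top w : w ∈ N)
  exact Module.Finite.of_fg_top (hW ▸ Submodule.fg_span_singleton v)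

variable {V : Type*} [AddCommGroup V] [Module ℂ V] [LieRingModule Sl2 V] [LieModule ℂ Sl2 V]

theorem Sl2.finrank_eq : Module.finrank ℂ Sl2 = 3 := by
  let e : Sl2 ≃ₗ[ℂ] (Fin 3 → ℂ) := LinearEquiv.ofBijective
    (LinearMap.pi ![Sl2.entry 0 0, Sl2.entry 0 1, Sl2.entry 1 0]) (by
      constructor
      · intro x y h
        exact Sl2.ext_entries (congrFun h 0) (congrFun h 1) (congrFun h 2)
      · intro c
        refine ⟨c 1 • sl2E + c 0 • sl2H + c 2 • sl2F, ?_⟩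
        ext i
        fin_cases i <;> simp [Sl2.entry_apply, sl2E, sl2H, sl2F])
  rw [e.finrank_eq, Module.finrank_fin_fun]

/-- If the elements of `sl₂` with nonzero kernel on `V` span `sl₂`, then `V` is
finite-dimensional. -/
theorem Sl2.finiteDimensional_of_span_eq_top [LieModule.IsIrreducible ℂ Sl2 V]
    (h : Submodule.span ℂ {x : Sl2 | ∃ v : V, v ≠ 0 ∧ ⁅x, v⁆ = 0} = ⊤) :
    FiniteDimensional ℂ V := by
  obtain ⟨s, hs, hspan, hli⟩ := exists_linearIndependent ℂ {x : Sl2 | ∃ v : V, v ≠ 0 ∧ ⁅x, v⁆ = 0}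
  rw [h] at hspan
  have : FiniteDimensional ℂ Sl2 := Module.finite_of_finrank_eq_succ Sl2.finrank_eq
  have hcard : Nat.card s = 3 := by
    rw [← Sl2.finrank_eq, Module.finrank_eq_nat_card_basis
      (Module.Basis.mk hli (by rw [Subtype.range_coe, hspan]))]
  obtain ⟨x, y, z, -, -, -, rfl⟩ := Set.ncard_eq_three.1 hcard
  exact LieModule.finiteDimensional_of_exists_lie_eq_zero hspan (hs (by simp)) (hs (by simp))
    (hs (by simp))

/-- If the elements with nonzero kernel do not span, a functional `β ≠ 0` kills them all, and `β ⊗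
ψ` is admissible for every `ψ`. This makes the action trivial. -/
theorem LieModule.IsActionDetermined.finiteDimensional [LieModule.IsIrreducible ℂ Sl2 V]
    (hdet : LieModule.IsActionDetermined ℂ Sl2 V) : FiniteDimensional ℂ V := by
  by_cases h : Submodule.span ℂ {x : Sl2 | ∃ v : V, v ≠ 0 ∧ ⁅x, v⁆ = 0} = ⊤
  · exact Sl2.finiteDimensional_of_span_eq_top h
  obtain ⟨β, hβ, hker⟩ := Submodule.exists_le_ker_of_lt_top _ (lt_top_iff_ne_top.2 h)
  have hβ0 : ∀ (x : Sl2) (v : V), ⁅x, v⁆ = 0 → v ≠ 0 → β x = 0 := fun x v hxv hv =>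
    hker (Submodule.subset_span ⟨v, hv, hxv⟩)
  obtain ⟨z, hz⟩ : ∃ z, β z = 1 := by
    obtain ⟨z, hz⟩ := DFunLike.ne_iff.1 hβ
    exact ⟨(β z)⁻¹ • z, by rw [map_smul, smul_eq_mul]; exact inv_mul_cancel₀ hz⟩
  have scalar : ∀ b : Sl2, β b = 0 → ∀ v : V, ⁅b, v⁆ = β ⁅z, b⁆ • v := by
    intro b hb v
    rw [← sub_eq_zero, ← Module.forall_dual_apply_eq_zero_iff ℂ]
    intro ψ
    obtain ⟨Ψ, hΨ⟩ := hdet (LinearMap.smulRight β ψ) (fun x w hxw => by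
      by_cases hw : w = 0
      · rw [hw, map_zero]
      · rw [LinearMap.smulRight_apply, hβ0 x w hxw hw, zero_smul, LinearMap.zero_apply])
    have hΨ' : ∀ x w, β x * ψ w = Ψ ⁅x, w⁆ := hΨ
    -- Expanding `z b v = [z, b] v + b z v` under `Ψ`, the last term drops out because `β b = 0`.
    have h1 := hΨ' z ⁅b, v⁆
    rw [leibniz_lie, map_add, ← hΨ', ← hΨ', hz, hb] at h1
    rw [map_sub, map_smul, smul_eq_mul]
    linear_combination h1
  -- Every element acts as a scalar plus a multiple of `z`, so all the operators commute.
  have lie_zero' : ∀ (x y : Sl2) (v : V), ⁅⁅x, y⁆, v⁆ = 0 := by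
    have act : ∀ x : Sl2, ∃ c : ℂ, ∀ v : V, ⁅x, v⁆ = c • v + β x • ⁅z, v⁆ := fun x => by
      refine ⟨β ⁅z, x - β x • z⁆, fun v => ?_⟩
      rw [← scalar _ (by rw [map_sub, map_smul, hz, smul_eq_mul, mul_one, sub_self]), sub_lie,
        smul_lie]
      abel
    intro x y v
    obtain ⟨c, hc⟩ := act x
    obtain ⟨d, hd⟩ := act y
    rw [lie_lie, hd v, hc v]
    simp only [lie_add, lie_smul, hc, hd]
    module
  refine LieModule.finiteDimensional_of_isTrivial fun x v => ?_
  have hE : ⁅sl2E, v⁆ = 0 := by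
    have := lie_zero' sl2H sl2E v
    rw [sl2_lie_H_E, smul_lie] at this
    exact (smul_eq_zero.1 this).resolve_left two_ne_zero
  have hF : ⁅sl2F, v⁆ = 0 := by
    have := lie_zero' sl2H sl2F v
    rw [sl2_lie_H_F, neg_lie, neg_eq_zero, smul_lie] at this
    exact (smul_eq_zero.1 this).resolve_left two_ne_zero
  have hH : ⁅sl2H, v⁆ = 0 := by rw [← sl2_lie_E_F]; exact lie_zero' _ _ v
  rw [Sl2.eq_combination x]
  simp only [add_lie, smul_lie, hE, hF, hH, smul_zero, add_zero]

end Determined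

/-! ### Weight bases of finite-dimensional simple modules -/

section WeightBasis

open Module

variable {L V : Type*} [LieRing L] [LieAlgebra ℂ L] [AddCommGroup V] [Module ℂ V]
  [LieRingModule L V] [LieModule ℂ L V]

/-- The basis `v 0, …, v n` of the irreducible `sl₂`-module of highest weight `n` obtained by
applying the lowering operator to the highest weight vector `v 0`. -/
structure IsWeightBasis (h e f : L) (n : ℕ) (v : ℕ → V) (b : Basis (Fin (n + 1)) ℂ V) :
    Prop where
  basis_apply : ∀ k, b k = v k
  eq_zero : ∀ k, n < k → v k = 0
  lie_f : ∀ k, ⁅f, v k⁆ = v (k + 1)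
  lie_h : ∀ k : ℕ, ⁅h, v k⁆ = ((n : ℂ) - 2 * k) • v k
  lie_e_zero : ⁅e, v 0⁆ = 0
  lie_e_succ : ∀ k : ℕ, ⁅e, v (k + 1)⁆ = (((k : ℂ) + 1) * (n - k)) • v k

/-- The string below a primitive vector is independent, its weights being distinct. Its span is
stable under `e`, `h`, `f`, so it is all of `V`. -/
theorem IsSl2Triple.exists_isWeightBasis [FiniteDimensional ℂ V] [LieModule.IsIrreducible ℂ L V]
    [LieModule.IsTriangularizable ℂ L V] {h e f : L} (t : IsSl2Triple h e f)
    (hspan : Submodule.span ℂ {e, h, f} = ⊤) :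
    ∃ (n : ℕ) (v : ℕ → V) (b : Basis (Fin (n + 1)) ℂ V), IsWeightBasis h e f n v b := by
  have := LieModule.nontrivial_of_isIrreducible ℂ L V
  obtain ⟨μ, v₀, hv₀, P⟩ := t.exists_hasPrimitiveVectorWith (R := ℂ) (M := V)
  obtain ⟨n, rfl⟩ := P.exists_nat
  let v : ℕ → V := fun k => ((LieModule.toEnd ℂ L V f) ^ k) v₀
  have hf : ∀ k, ⁅f, v k⁆ = v (k + 1) := P.lie_f_pow_toEnd_f
  have hh : ∀ k : ℕ, ⁅h, v k⁆ = ((n : ℂ) - 2 * k) • v k := P.lie_h_pow_toEnd_f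
  have he : ∀ k : ℕ, ⁅e, v (k + 1)⁆ = (((k : ℂ) + 1) * (n - k)) • v k := P.lie_e_pow_succ_toEnd_f
  have he0 : ⁅e, v 0⁆ = 0 := P.lie_e
  have hz : ∀ k, n < k → v k = 0 := by
    intro k hk
    induction k, hk using Nat.le_induction with
    | base => exact P.pow_toEnd_f_eq_zero_of_eq_nat rfl
    | succ k _ ih => rw [← hf, ih, lie_zero]
  have hli : LinearIndependent ℂ fun k : Fin (n + 1) => v k := by
    refine Module.End.eigenvectors_linearIndependent' (LieModule.toEnd ℂ L V h)
      (fun k : Fin (n + 1) => (n : ℂ) - 2 * (k : ℕ)) (fun i j hij => ?_) _ (fun k => ?_)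
    · have : ((i : ℕ) : ℂ) = (j : ℕ) := by
        have := hij
        simp only at this
        linear_combination (-1 / 2) * this
      exact Fin.ext (Nat.cast_injective this)
    · rw [Module.End.hasEigenvector_iff, Module.End.mem_eigenspace_iff]
      exact ⟨hh k, P.pow_toEnd_f_ne_zero_of_eq_nat rfl (Nat.lt_succ_iff.1 k.2)⟩
  let W : Submodule ℂ V := Submodule.span ℂ (Set.range fun k : Fin (n + 1) => v k)
  have hvW : ∀ k, v k ∈ W := fun k => by
    by_cases hk : n < k
    · rw [hz k hk]; exact W.zero_mem
    · exact Submodule.subset_span ⟨⟨k, by omega⟩, rfl⟩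
  have stable : ∀ x : L, (∀ k, ⁅x, v k⁆ ∈ W) → ∀ w ∈ W, ⁅x, w⁆ ∈ W := fun x hx w hw => by
    induction hw using Submodule.span_induction with
    | mem w hw => obtain ⟨k, rfl⟩ := hw; exact hx k
    | zero => rw [lie_zero]; exact W.zero_mem
    | add a b _ _ ha hb => rw [lie_add]; exact W.add_mem ha hb
    | smul c a _ ha => rw [lie_smul]; exact W.smul_mem c ha
  let N : LieSubmodule ℂ L V :=
    { W with
      lie_mem := fun {x w} hw => by
        obtain ⟨a, b, c, rfl⟩ := Submodule.mem_span_triple.1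
          (hspan ▸ Submodule.mem_top : x ∈ Submodule.span ℂ {e, h, f})
        refine stable _ (fun k => ?_) w hw
        rw [add_lie, add_lie, smul_lie, smul_lie, smul_lie, hf, hh]
        refine W.add_mem (W.add_mem (W.smul_mem _ ?_) (W.smul_mem _ (W.smul_mem _ (hvW _))))
          (W.smul_mem _ (hvW _))
        cases k with
        | zero => rw [he0]; exact W.zero_mem
        | succ k => rw [he]; exact W.smul_mem _ (hvW _) }
  have hN : N = ⊤ := LieModule.eq_top_of_mem N (hvW 0) hv₀
  have hW : ⊤ ≤ W := fun w _ => (hN ▸ LieSubmodule.mem_top w : w ∈ N)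
  exact ⟨n, v, Basis.mk hli hW, fun k => Basis.mk_apply hli hW k, hz, hf, hh, he0, he⟩

/-- A nonzero coordinate of `w` must sit at a weight `n - 2 k = 0`. -/
theorem IsWeightBasis.odd_finrank_of_lie_h_eq_zero {h e f : L} {n : ℕ} {v : ℕ → V}
    {b : Basis (Fin (n + 1)) ℂ V} (B : IsWeightBasis h e f n v b) {w : V} (hw0 : w ≠ 0)
    (hw : ⁅h, w⁆ = 0) : Odd (finrank ℂ V) := by
  have hsum : ∑ k, (b.repr w k * ((n : ℂ) - 2 * (k : ℕ))) • b k = 0 := by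
    rw [← hw]
    conv_rhs => rw [← b.sum_repr w]
    refine Eq.trans ?_ (map_sum (LieModule.action L V h) _ _).symm
    refine Finset.sum_congr rfl fun k _ => ?_
    change _ = ⁅h, b.repr w k • b k⁆
    rw [lie_smul, B.basis_apply, B.lie_h, smul_smul]
  have hcoef := Fintype.linearIndependent_iff.1 b.linearIndependent _ hsum
  obtain ⟨k, hk⟩ : ∃ k, b.repr w k ≠ 0 := by
    by_contra! hall
    exact hw0 (b.repr.map_eq_zero_iff.1 (Finsupp.ext hall))
  have h2 := (mul_eq_zero.1 (hcoef k)).resolve_left hk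
  have h3 : n = 2 * (k : ℕ) := by
    have : (n : ℂ) = ((2 * (k : ℕ) : ℕ) : ℂ) := by push_cast; linear_combination h2
    exact Nat.cast_injective this
  rw [Module.finrank_eq_card_basis b, Fintype.card_fin, h3]
  exact odd_two_mul_add_one _

end WeightBasis

/-! ### Triples through semisimple elements -/

/-- The traceless matrix with the given entries. -/
def Sl2.of (q r p : ℂ) : Sl2 := q • sl2H + r • sl2E + p • sl2F

theorem Sl2.of_zero_zero (q r p : ℂ) : (Sl2.of q r p).val 0 0 = q := by
  simp [Sl2.of, sl2E, sl2F, sl2H]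

theorem Sl2.of_zero_one (q r p : ℂ) : (Sl2.of q r p).val 0 1 = r := by
  simp [Sl2.of, sl2E, sl2F, sl2H]

theorem Sl2.of_one_zero (q r p : ℂ) : (Sl2.of q r p).val 1 0 = p := by
  simp [Sl2.of, sl2E, sl2F, sl2H]

theorem Sl2.of_eq_of {q r p q' r' p' : ℂ} (hq : q = q') (hr : r = r') (hp : p = p') :
    Sl2.of q r p = Sl2.of q' r' p' := by
  rw [hq, hr, hp]

theorem Sl2.lie_of_of (q r p q' r' p' : ℂ) :
    ⁅Sl2.of q r p, Sl2.of q' r' p'⁆ =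
      Sl2.of (r * p' - p * r') (2 * (q * r' - r * q')) (2 * (p * q' - q * p')) := by
  apply Sl2.ext_entries
  · rw [Sl2.lie_val_zero_zero]; simp only [Sl2.of_zero_zero, Sl2.of_zero_one, Sl2.of_one_zero]
  · rw [Sl2.lie_val_zero_one]; simp only [Sl2.of_zero_zero, Sl2.of_zero_one]
  · rw [Sl2.lie_val_one_zero]; simp only [Sl2.of_zero_zero, Sl2.of_one_zero]

theorem Sl2.smul_of (c q r p : ℂ) : c • Sl2.of q r p = Sl2.of (c * q) (c * r) (c * p) := by
  simp only [Sl2.of, smul_add, smul_smul]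

theorem Sl2.of_add_of (q r p q' r' p' : ℂ) :
    Sl2.of q r p + Sl2.of q' r' p' = Sl2.of (q + q') (r + r') (p + p') := by
  simp only [Sl2.of]
  module

theorem Sl2.exists_eq_of (x : Sl2) : ∃ q r p, x = Sl2.of q r p :=
  ⟨x.val 0 0, x.val 0 1, x.val 1 0, by
    rw [Sl2.of]
    conv_lhs => rw [Sl2.eq_combination x]
    abel⟩

theorem sl2E_eq_of : sl2E = Sl2.of 0 1 0 := by simp [Sl2.of]
theorem sl2H_eq_of : sl2H = Sl2.of 1 0 0 := by simp [Sl2.of]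
theorem sl2F_eq_of : sl2F = Sl2.of 0 0 1 := by simp [Sl2.of]

theorem Sl2.span_eq_top_of_mem {T : Submodule ℂ Sl2} (hE : sl2E ∈ T) (hH : sl2H ∈ T)
    (hF : sl2F ∈ T) : T = ⊤ := by
  rw [eq_top_iff]
  intro x _
  rw [Sl2.eq_combination x]
  exact T.add_mem (T.add_mem (T.smul_mem _ hE) (T.smul_mem _ hH)) (T.smul_mem _ hF)

theorem Sl2.span_standard_eq_top : Submodule.span ℂ {sl2E, sl2H, sl2F} = ⊤ :=
  Sl2.span_eq_top_of_mem (Submodule.subset_span (by simp)) (Submodule.subset_span (by simp))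
    (Submodule.subset_span (by simp))

theorem Sl2.isSl2Triple_of_lie {h e f : Sl2} (h0 : h ≠ 0) (hef : ⁅e, f⁆ = h)
    (he : ⁅h, e⁆ = (2 : ℂ) • e) (hf : ⁅h, f⁆ = (-2 : ℂ) • f) : IsSl2Triple h e f where
  h_ne_zero := h0
  lie_e_f := hef
  lie_h_e_nsmul := by rw [he, ofNat_smul_eq_nsmul]
  lie_h_f_nsmul := by rw [hf, neg_smul, ofNat_smul_eq_nsmul]

/-- A semisimple element of `sl₂` is up to scaling part of an `sl₂` triple spanning `sl₂`. -/
theorem Sl2.exists_isSl2Triple_of_ne_zero {q r p : ℂ} (hD : q ^ 2 + p * r ≠ 0) :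
    ∃ (c : ℂ) (e f : Sl2), IsSl2Triple (c • Sl2.of q r p) e f ∧
      Submodule.span ℂ {e, c • Sl2.of q r p, f} = ⊤ := by
  by_cases hp : p = 0
  · subst hp
    have hq : q ≠ 0 := fun hq => hD (by rw [hq]; ring)
    have hc : q⁻¹ • Sl2.of q r 0 = Sl2.of 1 (q⁻¹ * r) 0 := by
      rw [Sl2.smul_of, inv_mul_cancel₀ hq, mul_zero]
    set s := q⁻¹ * r
    refine ⟨q⁻¹, Sl2.of 0 1 0, Sl2.of (-s / 2) (-s ^ 2 / 4) 1, ?_, ?_⟩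
    · rw [hc]
      refine Sl2.isSl2Triple_of_lie (fun h => ?_) ?_ ?_ ?_
      · have := congrArg (fun x : Sl2 => x.val 0 0) h
        simp [Sl2.of_zero_zero] at this
      all_goals
        simp only [Sl2.lie_of_of, Sl2.smul_of]
        apply Sl2.of_eq_of <;> ring
    · rw [hc]
      have hE : sl2E ∈ Submodule.span ℂ {Sl2.of 0 1 0, Sl2.of 1 s 0,
          Sl2.of (-s / 2) (-s ^ 2 / 4) 1} := by
        rw [sl2E_eq_of]; exact Submodule.subset_span (by simp)
      have hH : sl2H ∈ Submodule.span ℂ {Sl2.of 0 1 0, Sl2.of 1 s 0,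
          Sl2.of (-s / 2) (-s ^ 2 / 4) 1} :=
        Submodule.mem_span_triple.2 ⟨-s, 1, 0, by
          simp only [sl2H_eq_of, Sl2.smul_of, Sl2.of_add_of]
          apply Sl2.of_eq_of <;> ring⟩
      refine Sl2.span_eq_top_of_mem hE hH (Submodule.mem_span_triple.2 ⟨-s ^ 2 / 4, s / 2, 1, ?_⟩)
      simp only [sl2F_eq_of, Sl2.smul_of, Sl2.of_add_of]
      apply Sl2.of_eq_of <;> ring
  -- The eigenvalues are `±δ`; dividing by `δ` makes them `±1`. The images of `e` and `f` are the
  -- eigenlines for `1` and `-1`, spanned by `(Q + 1, P)` and `(Q - 1, P)`, and the factor `1 / 4`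
  -- gives `[e, f] = h`.
  · obtain ⟨δ, hδ⟩ := IsAlgClosed.exists_pow_nat_eq (q ^ 2 + p * r) two_pos
    have hδ0 : δ ≠ 0 := fun h => hD (by rw [← hδ, h]; ring)
    obtain ⟨Q, hQ⟩ : ∃ Q, Q = δ⁻¹ * q := ⟨_, rfl⟩
    obtain ⟨P, hP⟩ : ∃ P, P = δ⁻¹ * p := ⟨_, rfl⟩
    have hP0 : P ≠ 0 := by rw [hP]; exact mul_ne_zero (inv_ne_zero hδ0) hp
    have hR : δ⁻¹ * r = (1 - Q ^ 2) / P := by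
      rw [hQ, hP]
      field_simp
      linear_combination -hδ
    have hc : δ⁻¹ • Sl2.of q r p = Sl2.of Q ((1 - Q ^ 2) / P) P := by
      rw [Sl2.smul_of, hR, ← hQ, ← hP]
    refine ⟨δ⁻¹, Sl2.of (1 + Q) (-(1 + Q) ^ 2 / P) P,
      Sl2.of (-(Q - 1) / 4) ((Q - 1) ^ 2 / (4 * P)) (-P / 4), ?_, ?_⟩
    · rw [hc]
      refine Sl2.isSl2Triple_of_lie (fun h => ?_) ?_ ?_ ?_
      · have := congrArg (fun x : Sl2 => x.val 1 0) h
        rw [Sl2.of_one_zero] at this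
        exact hP0 this
      all_goals
        simp only [Sl2.lie_of_of, Sl2.smul_of]
        apply Sl2.of_eq_of <;> field_simp <;> ring
    · rw [hc]
      refine Sl2.span_eq_top_of_mem
        (Submodule.mem_span_triple.2 ⟨-P / 4, P / 2, P, ?_⟩)
        (Submodule.mem_span_triple.2 ⟨(1 - Q) / 2, Q, 2 * (1 + Q), ?_⟩)
        (Submodule.mem_span_triple.2 ⟨(1 - Q) ^ 2 / (4 * P), (1 - Q ^ 2) / (2 * P),
          -(1 + Q) ^ 2 / P, ?_⟩)
      · simp only [sl2E_eq_of, Sl2.smul_of, Sl2.of_add_of]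
        apply Sl2.of_eq_of <;> field_simp <;> ring
      · simp only [sl2H_eq_of, Sl2.smul_of, Sl2.of_add_of]
        apply Sl2.of_eq_of <;> field_simp <;> ring
      · simp only [sl2F_eq_of, Sl2.smul_of, Sl2.of_add_of]
        apply Sl2.of_eq_of <;> field_simp <;> ring

/-! ### Failure in even dimension at least four -/

section EvenDimension

variable {V : Type*} [AddCommGroup V] [Module ℂ V] [LieRingModule Sl2 V] [LieModule ℂ Sl2 V]

/-- Since `q ^ 2 + p * r` is minus the determinant, the element is semisimple, and its kernel is a
zero weight space. -/
theorem Sl2.odd_finrank_of_lie_eq_zero [FiniteDimensional ℂ V] [LieModule.IsIrreducible ℂ Sl2 V]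
    {q r p : ℂ} (hD : q ^ 2 + p * r ≠ 0) {w : V} (hw0 : w ≠ 0) (hw : ⁅Sl2.of q r p, w⁆ = 0) :
    Odd (Module.finrank ℂ V) := by
  obtain ⟨c, e, f, t, hspan⟩ := Sl2.exists_isSl2Triple_of_ne_zero hD
  obtain ⟨n, v, b, B⟩ := t.exists_isWeightBasis (V := V) hspan
  exact B.odd_finrank_of_lie_h_eq_zero hw0 (by rw [smul_lie, hw, smul_zero])

theorem LieModule.IsActionDetermined.finrank_eq_two_or_odd [FiniteDimensional ℂ V]
    [LieModule.IsIrreducible ℂ Sl2 V] (hdet : LieModule.IsActionDetermined ℂ Sl2 V) :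
    Module.finrank ℂ V = 2 ∨ Odd (Module.finrank ℂ V) := by
  by_contra! hcon
  obtain ⟨hne, hodd⟩ := hcon
  obtain ⟨n, v, b, B⟩ := isSl2Triple_standard.exists_isWeightBasis (V := V) Sl2.span_standard_eq_top
  have hdim : Module.finrank ℂ V = n + 1 := by
    rw [Module.finrank_eq_card_basis b, Fintype.card_fin]
  rw [hdim] at hne
  have hn0 : (n : ℂ) ≠ 0 := by
    rintro h
    rw [Nat.cast_eq_zero] at h
    exact hodd (by rw [hdim, h]; exact odd_one)
  have hn1 : (n : ℂ) - 1 ≠ 0 := fun h => by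
    have : (n : ℂ) = (1 : ℕ) := by push_cast; linear_combination h
    exact hne (by rw [Nat.cast_injective this])
  -- `ψ` is the coordinate along `v 0`.
  obtain ⟨ψ, hψf, hψh, v₀, hv₀⟩ : ∃ ψ : V →ₗ[ℂ] ℂ, (∀ w, ψ ⁅sl2F, w⁆ = 0) ∧
      (∀ w, ψ ⁅sl2H, w⁆ = n * ψ w) ∧ ∃ w, ψ w ≠ 0 := by
    have hψ : ∀ k, b.coord 0 (v k) = if k = 0 then 1 else 0 := fun k => by
      by_cases hk : n < k
      · rw [B.eq_zero k hk, map_zero, if_neg (by omega)]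
      · have := B.basis_apply ⟨k, by omega⟩
        simp only at this
        rw [← this, Module.Basis.coord_apply, b.repr_self, Finsupp.single_apply]
        simp [Fin.ext_iff]
    refine ⟨b.coord 0, fun w => ?_, fun w => ?_, v 0, by simp [hψ]⟩
    · have : b.coord 0 ∘ₗ LieModule.action Sl2 V sl2F = 0 := b.ext fun k => by
        change b.coord 0 ⁅sl2F, b k⁆ = 0
        rw [B.basis_apply, B.lie_f, hψ, if_neg (Nat.succ_ne_zero _)]
      exact LinearMap.congr_fun this w
    · have : b.coord 0 ∘ₗ LieModule.action Sl2 V sl2H = (n : ℂ) • b.coord 0 := b.ext fun k => by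
        change b.coord 0 ⁅sl2H, b k⁆ = n * b.coord 0 (b k)
        rw [B.basis_apply, B.lie_h, map_smul, hψ, smul_eq_mul]
        split_ifs with hk
        · rw [hk]; simp
        · simp
      exact LinearMap.congr_fun this w
  have hEF : ∀ w : V, ⁅sl2E, ⁅sl2F, w⁆⁆ = ⁅sl2F, ⁅sl2E, w⁆⁆ + ⁅sl2H, w⁆ := fun w => by
    rw [leibniz_lie sl2E sl2F w, sl2_lie_E_F, add_comm]
  have hEH : ∀ w : V, ⁅sl2E, ⁅sl2H, w⁆⁆ = ⁅sl2H, ⁅sl2E, w⁆⁆ - (2 : ℂ) • ⁅sl2E, w⁆ := fun w => by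
    rw [leibniz_lie sl2H sl2E w, sl2_lie_H_E, smul_lie]
    abel
  -- The coefficient `n - 1` is chosen so that, when `x w = 0`, `r * g x w` is a multiple of `q ^ 2
  -- + p * r`: apply `ψ` and `ψ ∘ e` to `x w = 0` and combine with weights `q` and `r`.
  let g : Sl2 →ₗ[ℂ] V →ₗ[ℂ] ℂ :=
    ((n : ℂ) - 1) • (Sl2.entry 0 0).smulRight (ψ ∘ₗ LieModule.action Sl2 V sl2E) +
      (Sl2.entry 0 1).smulRight
        (ψ ∘ₗ LieModule.action Sl2 V sl2E ∘ₗ LieModule.action Sl2 V sl2E)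
  have hg : ∀ q r p w, g (Sl2.of q r p) w =
      (n - 1) * (q * ψ ⁅sl2E, w⁆) + r * ψ ⁅sl2E, ⁅sl2E, w⁆⁆ := fun q r p w => by
    change (n - 1) * ((Sl2.of q r p).val 0 0 * ψ ⁅sl2E, w⁆) +
      (Sl2.of q r p).val 0 1 * ψ ⁅sl2E, ⁅sl2E, w⁆⁆ = _
    rw [Sl2.of_zero_zero, Sl2.of_zero_one]
  obtain ⟨Ψ, hΨ⟩ := hdet g (by
    intro x w hxw
    obtain ⟨q, r, p, rfl⟩ := Sl2.exists_eq_of x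
    by_cases hw0 : w = 0
    · rw [hw0, map_zero]
    have hD : q ^ 2 + p * r = 0 := by
      by_contra hD
      exact hodd (Sl2.odd_finrank_of_lie_eq_zero hD hw0 hxw)
    have hx : q • ⁅sl2H, w⁆ + r • ⁅sl2E, w⁆ + p • ⁅sl2F, w⁆ = 0 := by
      rw [← hxw, Sl2.of, add_lie, add_lie, smul_lie, smul_lie, smul_lie]
    have h1 := congrArg ψ hx
    have h2 := congrArg (fun w => ψ ⁅sl2E, w⁆) hx
    simp only [map_add, map_smul, lie_add, lie_smul, hEF, hEH, hψf, hψh, map_sub, map_zero,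
      lie_zero, smul_eq_mul] at h1 h2
    rw [hg]
    by_cases hr : r = 0
    · have hq : q = 0 := by simpa [hr] using hD
      rw [hr, hq]; ring
    · apply mul_left_cancel₀ hr
      linear_combination r * h2 + q * h1 - n * ψ w * hD)
  have hgE : ∀ w, ψ ⁅sl2E, ⁅sl2E, w⁆⁆ = Ψ ⁅sl2E, w⁆ := fun w => by
    have e := hg 0 1 0 w
    rw [← sl2E_eq_of, hΨ] at e
    linear_combination -e
  have hgH : ∀ w, (n - 1) * ψ ⁅sl2E, w⁆ = Ψ ⁅sl2H, w⁆ := fun w => by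
    have e := hg 1 0 0 w
    rw [← sl2H_eq_of, hΨ] at e
    linear_combination -e
  have hgF : ∀ w, Ψ ⁅sl2F, w⁆ = 0 := fun w => by
    have e := hg 0 0 1 w
    rw [← sl2F_eq_of, hΨ] at e
    linear_combination e
  -- Evaluating `hgE` at `f w` gives `2 (n - 1) ψ (e w)` on the left and `(n - 1) ψ (e w)` on the
  -- right.
  have hE0 : ∀ w, ψ ⁅sl2E, w⁆ = 0 := fun w => by
    have h1 := hgE ⁅sl2F, w⁆
    rw [hEF] at h1
    simp only [lie_add, hEF, hEH, map_add, map_sub, map_smul, hψf, hψh, hgF, smul_eq_mul] at h1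
    rw [← hgH] at h1
    apply mul_left_cancel₀ hn1
    linear_combination h1
  have h1 := hE0 ⁅sl2F, v₀⁆
  rw [hEF, map_add, hψf, hψh, zero_add] at h1
  exact (mul_ne_zero hn0 hv₀) h1

end EvenDimension

/-! ### Exponentials and orbits in `sl₂ ⊗ V` -/

open scoped TensorProduct

/-- This is `exp (s (a + b)) = exp (s a) exp (s b)` as finite sums; `2 * d` terms suffice because
`(a + b) ^ (2 * d) = 0`. -/
theorem exp_sum_add_eq_mul {A : Type*} [Ring A] [Algebra ℂ A] {a b : A} (hab : Commute a b) {d : ℕ}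
    (ha : a ^ d = 0) (hb : b ^ d = 0) (s : ℂ) :
    ∑ k ∈ Finset.range (2 * d), (s ^ k * (Nat.factorial k : ℂ)⁻¹) • (a + b) ^ k =
      (∑ i ∈ Finset.range d, (s ^ i * (Nat.factorial i : ℂ)⁻¹) • a ^ i) *
        ∑ j ∈ Finset.range d, (s ^ j * (Nat.factorial j : ℂ)⁻¹) • b ^ j := by
  let _ : Module ℚ A := Module.compHom A (algebraMap ℚ ℂ)
  have hq : ∀ (k : ℕ) (x : A), ((Nat.factorial k : ℚ)⁻¹) • (s • x) ^ k = (s ^ k * (Nat.factorial k : ℂ)⁻¹) • x ^ k := by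
    intro k x
    change (algebraMap ℚ ℂ (Nat.factorial k : ℚ)⁻¹) • (s • x) ^ k = _
    rw [smul_pow, smul_smul, map_inv₀, map_natCast, mul_comm]
  have hsum : ∀ (x : A) (m : ℕ), x ^ m = 0 → IsNilpotent.exp (s • x) =
      ∑ k ∈ Finset.range m, (s ^ k * (Nat.factorial k : ℂ)⁻¹) • x ^ k := by
    intro x m hx
    rw [IsNilpotent.exp_eq_sum (k := m) (by rw [smul_pow, hx, smul_zero])]
    exact Finset.sum_congr rfl fun k _ => hq k x
  have hnil : (a + b) ^ (2 * d) = 0 := by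
    rw [hab.add_pow]
    refine Finset.sum_eq_zero fun k hk => ?_
    by_cases hkd : d ≤ k
    · rw [pow_eq_zero_of_le hkd ha, zero_mul, zero_mul]
    · rw [pow_eq_zero_of_le (m := d) (by omega) hb, mul_zero, zero_mul]
  rw [← hsum _ _ hnil, ← hsum _ _ ha, ← hsum _ _ hb, smul_add]
  exact IsNilpotent.exp_add_of_commute ((hab.smul_left s).smul_right s)
    ⟨d, by rw [smul_pow, ha, smul_zero]⟩ ⟨d, by rw [smul_pow, hb, smul_zero]⟩

theorem eq_zero_of_forall_sum_pow_mul_eq_zero {d : ℕ} {c : ℕ → ℂ}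
    (h : ∀ s : ℂ, ∑ k ∈ Finset.range d, s ^ k * c k = 0) {k : ℕ} (hk : k < d) : c k = 0 := by
  let p : Polynomial ℂ := ∑ k ∈ Finset.range d, Polynomial.monomial k (c k)
  have hp : p = 0 := Polynomial.funext fun s => by
    rw [Polynomial.eval_finsetSum, Polynomial.eval_zero, ← h s]
    exact Finset.sum_congr rfl fun k _ => by rw [Polynomial.eval_monomial, mul_comm]
  have := congrArg (fun p => Polynomial.coeff p k) hp
  simpa [p, Polynomial.finsetSum_coeff, Polynomial.coeff_monomial, hk] using this

section TensorAction

variable {L V : Type*} [LieRing L] [LieAlgebra ℂ L] [AddCommGroup V] [Module ℂ V]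
  [LieRingModule L V] [LieModule ℂ L V]

/-- The action of `z` on `L ⊗ V`. -/
def LieModule.tensorAction (L V : Type*) [LieRing L] [LieAlgebra ℂ L] [AddCommGroup V]
    [Module ℂ V] [LieRingModule L V] [LieModule ℂ L V] (z : L) : Module.End ℂ (L ⊗[ℂ] V) :=
  (LieModule.action L L z).rTensor V + (LieModule.action L V z).lTensor L

theorem LieModule.tensorAction_tmul (z x : L) (v : V) :
    LieModule.tensorAction L V z (x ⊗ₜ v) = ⁅z, x⁆ ⊗ₜ v + x ⊗ₜ ⁅z, v⁆ := rfl

theorem LieModule.tensorAction_pow_succ_tmul (z x : L) (v : V) (k : ℕ) :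
    (LieModule.tensorAction L V z ^ (k + 1)) (x ⊗ₜ v) =
      (LieModule.tensorAction L V z ^ k) (⁅z, x⁆ ⊗ₜ v) +
        (LieModule.tensorAction L V z ^ k) (x ⊗ₜ ⁅z, v⁆) := by
  rw [pow_succ, Module.End.mul_apply, LieModule.tensorAction_tmul, map_add]

/-- Bilinear maps vanishing on the pairs with `x v = 0` vanish on the whole orbit of such a pair
under an element acting nilpotently. -/
theorem LieModule.lift_tensorAction_pow_eq_zero {g : L →ₗ[ℂ] V →ₗ[ℂ] ℂ}
    (hg : ∀ (x : L) (v : V), ⁅x, v⁆ = 0 → g x v = 0) {z : L} {d : ℕ}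
    (hL : LieModule.action L L z ^ d = 0) (hV : LieModule.action L V z ^ d = 0) {x : L} {v : V}
    (hxv : ⁅x, v⁆ = 0) (k : ℕ) :
    TensorProduct.lift g ((LieModule.tensorAction L V z ^ k) (x ⊗ₜ v)) = 0 := by
  set a : Module.End ℂ (L ⊗[ℂ] V) := (LieModule.action L L z).rTensor V with ha_def
  set b : Module.End ℂ (L ⊗[ℂ] V) := (LieModule.action L V z).lTensor L with hb_def
  have hD : LieModule.tensorAction L V z = a + b := rfl
  have hab : Commute a b := TensorProduct.ext' fun x v => rfl
  have hapow : ∀ i, a ^ i = (LieModule.action L L z ^ i).rTensor V := fun i => by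
    rw [ha_def, LinearMap.rTensor_pow]
  have hbpow : ∀ i, b ^ i = (LieModule.action L V z ^ i).lTensor L := fun i => by
    rw [hb_def, LinearMap.lTensor_pow]
  have ha : a ^ d = 0 := by rw [hapow, hL, LinearMap.rTensor_zero]
  have hb : b ^ d = 0 := by rw [hbpow, hV, LinearMap.lTensor_zero]
  let m : L ⊗[ℂ] V →ₗ[ℂ] V := TensorProduct.lift (LieModule.action L V)
  have hm : ∀ t, m (LieModule.tensorAction L V z t) = ⁅z, m t⁆ := fun t => by
    induction t using TensorProduct.induction_on with
    | zero => rw [map_zero, map_zero, lie_zero]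
    | tmul y w => exact (leibniz_lie z y w).symm
    | add t u ht hu => rw [map_add, map_add, ht, hu, map_add, lie_add]
  have hmpow : ∀ k, m ((LieModule.tensorAction L V z ^ k) (x ⊗ₜ v)) = 0 := fun k => by
    induction k with
    | zero => exact hxv
    | succ k ih => rw [pow_succ', Module.End.mul_apply, hm, ih, lie_zero]
  -- The exponential of the tensor action sends `x ⊗ v` to a pure tensor, to which `hg` can be
  -- applied.
  have hexp : ∀ s : ℂ, ∑ k ∈ Finset.range (2 * d), (s ^ k * (Nat.factorial k : ℂ)⁻¹) •
      (LieModule.tensorAction L V z ^ k) (x ⊗ₜ v) =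
      (∑ i ∈ Finset.range d, (s ^ i * (Nat.factorial i : ℂ)⁻¹) • (LieModule.action L L z ^ i) x) ⊗ₜ
        (∑ j ∈ Finset.range d, (s ^ j * (Nat.factorial j : ℂ)⁻¹) • (LieModule.action L V z ^ j) v) := by
    intro s
    have := LinearMap.congr_fun (exp_sum_add_eq_mul hab ha hb s) (x ⊗ₜ v)
    simp only [LinearMap.sum_apply, LinearMap.smul_apply, Module.End.mul_apply, hapow, hbpow,
      LinearMap.lTensor_tmul] at this
    rw [hD, this]
    rw [TensorProduct.sum_tmul]
    refine Finset.sum_congr rfl fun i _ => ?_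
    simp only [← TensorProduct.tmul_smul, ← TensorProduct.tmul_sum, LinearMap.rTensor_tmul]
    rw [TensorProduct.tmul_smul, TensorProduct.smul_tmul']
  -- The action map is equivariant, so the moved pair still has product zero. This gives a
  -- polynomial in `s` that vanishes identically.
  have hvan : ∀ s : ℂ, ∑ k ∈ Finset.range (2 * d), s ^ k * ((Nat.factorial k : ℂ)⁻¹ *
      TensorProduct.lift g ((LieModule.tensorAction L V z ^ k) (x ⊗ₜ v))) = 0 := by
    intro s
    have h1 := congrArg m (hexp s)
    simp only [map_sum, map_smul, hmpow, smul_zero, Finset.sum_const_zero] at h1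
    have h2 := congrArg (TensorProduct.lift g) (hexp s)
    rw [TensorProduct.lift.tmul, hg _ _ h1.symm] at h2
    simpa only [map_sum, map_smul, smul_eq_mul, mul_assoc] using h2
  by_cases hk : k < 2 * d
  · have := eq_zero_of_forall_sum_pow_mul_eq_zero hvan hk
    exact (mul_eq_zero.1 this).resolve_left
      (inv_ne_zero (Nat.cast_ne_zero.2 (Nat.factorial_ne_zero k)))
  · have hnil : (a + b) ^ k = 0 := by
      rw [hab.add_pow]
      refine Finset.sum_eq_zero fun i hi => ?_
      by_cases hid : d ≤ i
      · rw [pow_eq_zero_of_le hid ha, zero_mul, zero_mul]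
      · rw [pow_eq_zero_of_le (m := d) (by omega) hb, mul_zero, zero_mul]
    rw [hD, hnil, LinearMap.zero_apply, map_zero]

end TensorAction

theorem sl2_action_E_pow_three : LieModule.action Sl2 Sl2 sl2E ^ 3 = 0 := by
  refine LinearMap.ext fun x => ?_
  obtain ⟨q, r, p, rfl⟩ := Sl2.exists_eq_of x
  change ⁅sl2E, ⁅sl2E, ⁅sl2E, Sl2.of q r p⁆⁆⁆ = 0
  simp only [sl2E_eq_of, Sl2.lie_of_of]
  simp [Sl2.of]

theorem sl2_action_F_pow_three : LieModule.action Sl2 Sl2 sl2F ^ 3 = 0 := by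
  refine LinearMap.ext fun x => ?_
  obtain ⟨q, r, p, rfl⟩ := Sl2.exists_eq_of x
  change ⁅sl2F, ⁅sl2F, ⁅sl2F, Sl2.of q r p⁆⁆⁆ = 0
  simp only [sl2F_eq_of, Sl2.lie_of_of]
  simp [Sl2.of]

theorem sl2_lie_F_E : ⁅sl2F, sl2E⁆ = -sl2H := by rw [← lie_skew, sl2_lie_E_F]
theorem sl2_lie_F_H : ⁅sl2F, sl2H⁆ = (2 : ℂ) • sl2F := by rw [← lie_skew, sl2_lie_H_F, neg_neg]
theorem sl2_lie_E_H : ⁅sl2E, sl2H⁆ = (-2 : ℂ) • sl2E := by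
  rw [← lie_skew, sl2_lie_H_E, neg_smul]

/-! ### Dimension two and odd dimension -/

section OddDimension

theorem IsWeightBasis.linearMap_eq_zero {V : Type*} [AddCommGroup V] [Module ℂ V]
    [LieRingModule Sl2 V] {n : ℕ} {v : ℕ → V} {b : Module.Basis (Fin (n + 1)) ℂ V}
    (B : IsWeightBasis sl2H sl2E sl2F n v b)
    {φ : V →ₗ[ℂ] ℂ}
    (h : ∀ k, φ (v k) = 0) : φ = 0 :=
  b.ext fun k => by rw [B.basis_apply, h, LinearMap.zero_apply]

theorem IsWeightBasis.end_eq_zero {V : Type*} [AddCommGroup V] [Module ℂ V]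
    [LieRingModule Sl2 V] {n : ℕ} {v : ℕ → V} {b : Module.Basis (Fin (n + 1)) ℂ V}
    (B : IsWeightBasis sl2H sl2E sl2F n v b)
    {φ : Module.End ℂ V}
    (h : ∀ k ≤ n, φ (v k) = 0) : φ = 0 :=
  b.ext fun k => by rw [B.basis_apply, h _ (by omega), LinearMap.zero_apply]

variable {V : Type*} [AddCommGroup V] [Module ℂ V] [LieRingModule Sl2 V] [LieModule ℂ Sl2 V]
  {n : ℕ} {v : ℕ → V} {b : Module.Basis (Fin (n + 1)) ℂ V}

theorem IsWeightBasis.action_F_pow (B : IsWeightBasis sl2H sl2E sl2F n v b) :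
    LieModule.action Sl2 V sl2F ^ (n + 3) = 0 := by
  have h : ∀ i k, (LieModule.action Sl2 V sl2F ^ i) (v k) = v (k + i) := fun i => by
    induction i with
    | zero => exact fun _ => rfl
    | succ i ih =>
      intro k
      rw [pow_succ, Module.End.mul_apply]
      change (LieModule.action Sl2 V sl2F ^ i) ⁅sl2F, v k⁆ = _
      rw [B.lie_f, ih, add_right_comm, add_assoc]
  exact B.end_eq_zero fun k _ => by rw [h, B.eq_zero _ (by omega)]

theorem IsWeightBasis.action_E_pow (B : IsWeightBasis sl2H sl2E sl2F n v b) :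
    LieModule.action Sl2 V sl2E ^ (n + 3) = 0 := by
  have h : ∀ i k, k < i → (LieModule.action Sl2 V sl2E ^ i) (v k) = 0 := fun i => by
    induction i with
    | zero => exact fun k hk => absurd hk (Nat.not_lt_zero k)
    | succ i ih =>
      intro k hk
      rw [pow_succ, Module.End.mul_apply]
      change (LieModule.action Sl2 V sl2E ^ i) ⁅sl2E, v k⁆ = 0
      cases k with
      | zero => rw [B.lie_e_zero, map_zero]
      | succ k => rw [B.lie_e_succ, map_smul, ih k (by omega), smul_zero]
  exact B.end_eq_zero fun k hk => h _ _ (by omega)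

theorem IsWeightBasis.exists_action_E_pow (B : IsWeightBasis sl2H sl2E sl2F n v b) {m : ℕ}
    (hm : m ≤ n) (i j : ℕ) (hij : i + j = m) :
    ∃ α : ℂ, α ≠ 0 ∧ (LieModule.action Sl2 V sl2E ^ i) (v m) = α • v j := by
  induction i generalizing j with
  | zero => exact ⟨1, one_ne_zero, by rw [one_smul, ← hij, zero_add]; rfl⟩
  | succ i ih =>
    obtain ⟨α, hα, h⟩ := ih (j + 1) (by omega)
    have hnj : (n : ℂ) - j ≠ 0 := by
      rw [sub_ne_zero]
      exact fun h => absurd (Nat.cast_injective h) (by omega)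
    refine ⟨α * (((j : ℂ) + 1) * (n - j)),
      mul_ne_zero hα (mul_ne_zero (Nat.cast_add_one_ne_zero j) hnj), ?_⟩
    rw [pow_succ', Module.End.mul_apply, h, map_smul]
    change α • ⁅sl2E, v (j + 1)⁆ = _
    rw [B.lie_e_succ, smul_smul]

/-- A bilinear map on `sl₂ × V` that vanishes on the pairs with `x v = 0` and is normalised by
`g(f, ·) = 0` and `g(h, v₀) = 0` vanishes, if `dim V` is `2` or odd. -/
theorem IsWeightBasis.eq_zero_of_normalised (B : IsWeightBasis sl2H sl2E sl2F n v b)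
    (hn : n = 1 ∨ Even n) {g : Sl2 →ₗ[ℂ] V →ₗ[ℂ] ℂ}
    (hg : ∀ (x : Sl2) (w : V), ⁅x, w⁆ = 0 → g x w = 0) (hgF : ∀ w, g sl2F w = 0)
    (hgH0 : g sl2H (v 0) = 0) : g = 0 := by
  let G := TensorProduct.lift g
  let DE := LieModule.tensorAction Sl2 V sl2E
  let DF := LieModule.tensorAction Sl2 V sl2F
  have van_F : ∀ {x : Sl2} {w : V}, ⁅x, w⁆ = 0 → ∀ k, G ((DF ^ k) (x ⊗ₜ w)) = 0 := fun hxw k =>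
    LieModule.lift_tensorAction_pow_eq_zero hg
      (pow_eq_zero_of_le (by omega : 3 ≤ n + 3) sl2_action_F_pow_three) B.action_F_pow hxw k
  have van_E : ∀ {x : Sl2} {w : V}, ⁅x, w⁆ = 0 → ∀ k, G ((DE ^ k) (x ⊗ₜ w)) = 0 := fun hxw k =>
    LieModule.lift_tensorAction_pow_eq_zero hg
      (pow_eq_zero_of_le (by omega : 3 ≤ n + 3) sl2_action_E_pow_three) B.action_E_pow hxw k
  have stepF := fun (x : Sl2) (w : V) => LieModule.tensorAction_pow_succ_tmul sl2F x w
  have stepE := fun (x : Sl2) (w : V) => LieModule.tensorAction_pow_succ_tmul sl2E x w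
  have FF : ∀ k j, G ((DF ^ k) (sl2F ⊗ₜ v j)) = 0 := fun k => by
    induction k with
    | zero => exact fun j => hgF _
    | succ k ih =>
      intro j
      rw [stepF, lie_self, TensorProduct.zero_tmul, map_zero, zero_add, B.lie_f, ih]
  have FH : ∀ k j, G ((DF ^ k) (sl2H ⊗ₜ v j)) = g sl2H (v (j + k)) := fun k => by
    induction k with
    | zero => exact fun j => rfl
    | succ k ih =>
      intro j
      rw [stepF, sl2_lie_F_H, B.lie_f, ← TensorProduct.smul_tmul', map_smul, map_add, map_smul, FF,
        smul_zero, zero_add, ih, add_right_comm, add_assoc]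
  -- `ad f` sends `e` to `-h` and `h` to `2 f`; terms containing `f` vanish by `hgF`.
  have FE : ∀ k j, G ((DF ^ (k + 1)) (sl2E ⊗ₜ v j)) =
      g sl2E (v (j + k + 1)) - (k + 1) * g sl2H (v (j + k)) := fun k => by
    induction k with
    | zero =>
      intro j
      rw [stepF, sl2_lie_F_E, B.lie_f, TensorProduct.neg_tmul, map_neg, map_add, map_neg, FH]
      change _ + g sl2E (v (j + 1)) = _
      rw [Nat.cast_zero, add_zero]
      ring
    | succ k ih =>
      intro j
      rw [stepF, sl2_lie_F_E, B.lie_f, TensorProduct.neg_tmul, map_neg, map_add, map_neg, FH, ih,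
        show j + 1 + k = j + (k + 1) by omega]
      push_cast
      ring
  have EE : ∀ (k : ℕ) (w : V), G ((DE ^ k) (sl2E ⊗ₜ w)) =
      g sl2E ((LieModule.action Sl2 V sl2E ^ k) w) := fun k => by
    induction k with
    | zero => exact fun w => rfl
    | succ k ih =>
      intro w
      rw [stepE, lie_self, TensorProduct.zero_tmul, map_zero, zero_add, ih]
      rfl
  have hpow : ∀ (k : ℕ) (w : V), (LieModule.action Sl2 V sl2E ^ (k + 1)) w =
      (LieModule.action Sl2 V sl2E ^ k) ⁅sl2E, w⁆ := fun k w => by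
    rw [pow_succ]; rfl
  have EH : ∀ (k : ℕ) (w : V), G ((DE ^ (k + 1)) (sl2H ⊗ₜ w)) =
      g sl2H ((LieModule.action Sl2 V sl2E ^ (k + 1)) w) -
        2 * (k + 1) * g sl2E ((LieModule.action Sl2 V sl2E ^ k) w) := fun k => by
    induction k with
    | zero =>
      intro w
      rw [stepE, sl2_lie_E_H, ← TensorProduct.smul_tmul', map_smul, map_add, map_smul, EE]
      change _ + g sl2H ⁅sl2E, w⁆ = g sl2H ⁅sl2E, w⁆ - _
      rw [Nat.cast_zero, smul_eq_mul]
      ring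
    | succ k ih =>
      intro w
      rw [stepE, sl2_lie_E_H, ← TensorProduct.smul_tmul', map_smul, map_add, map_smul, EE, ih,
        hpow (k + 1) w, hpow k w, smul_eq_mul]
      push_cast
      ring
  -- The `f`-orbit of the pair `e`, `v 0`.
  have relE : ∀ k : ℕ, g sl2E (v (k + 1)) = (k + 1) * g sl2H (v k) := fun k => by
    have := FE k 0
    rw [van_F B.lie_e_zero] at this
    rw [zero_add] at this
    linear_combination -this
  have hgH : ∀ j, g sl2H (v j) = 0 := by
    intro j
    by_cases hj0 : j = 0
    · rw [hj0, hgH0]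
    by_cases hjn : n < j
    · rw [B.eq_zero j hjn, map_zero]
    rcases hn with h1 | ⟨m, hm⟩
    -- For `n = 1` only `j = 1` is left, and `relE` settles it because `v 2 = 0`.
    · have hj : j = n := by omega
      have := relE j
      rw [B.eq_zero (j + 1) (by omega), map_zero] at this
      exact (mul_eq_zero.1 this.symm).resolve_left (Nat.cast_add_one_ne_zero j)
    -- The zero weight vector is the second seed: its `f`-orbit handles `j ≥ m`, its `e`-orbit `j <
    -- m`.
    · have hHm : ⁅sl2H, v m⁆ = 0 := by
        rw [B.lie_h, hm]
        push_cast
        rw [show (m : ℂ) + m - 2 * m = 0 by ring, zero_smul]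
      by_cases hmj : m ≤ j
      · have := FH (j - m) m
        rw [van_F hHm, Nat.add_sub_cancel' hmj] at this
        exact this.symm
      · obtain ⟨i, hi⟩ : ∃ i, i + 1 + j = m := ⟨m - j - 1, by omega⟩
        have hnm : (n : ℂ) = 2 * (i + 1 + j) := by
          rw [hm, ← hi]; push_cast; ring
        obtain ⟨α, hα, hαv⟩ := B.exists_action_E_pow (by omega) i (j + 1) (by omega : _ = m)
        have := EH i (v m)
        rw [van_E hHm, pow_succ', Module.End.mul_apply, hαv, map_smul, map_smul, map_smul,
          relE j] at this
        change 0 = α * g sl2H ⁅sl2E, v (j + 1)⁆ - _ * (α * _) at this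
        rw [B.lie_e_succ, map_smul, smul_eq_mul] at this
        -- With `n = 2 (i + 1 + j)`, the factor `(n - j) - 2 (i + 1)` equals `j`. It vanishes at `j
        -- = 0`, where the normalisation `hgH0` is needed instead.
        have h2 : (α * ((j : ℂ) + 1) * j) * g sl2H (v j) = 0 := by
          linear_combination -this - α * (j + 1) * g sl2H (v j) * hnm
        exact (mul_eq_zero.1 h2).resolve_left (mul_ne_zero
          (mul_ne_zero hα (Nat.cast_add_one_ne_zero j)) (Nat.cast_ne_zero.2 hj0))
  have hF : g sl2F = 0 := LinearMap.ext hgF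
  have hH : g sl2H = 0 := B.linearMap_eq_zero hgH
  have hE : g sl2E = 0 := B.linearMap_eq_zero fun k => by
    cases k with
    | zero => exact hg _ _ B.lie_e_zero
    | succ k => rw [relE, hgH, mul_zero]
  refine LinearMap.ext fun x => ?_
  rw [Sl2.eq_combination x]
  simp only [map_add, map_smul, hF, hH, hE, smul_zero, add_zero, LinearMap.zero_apply]

theorem LieModule.isActionDetermined_of_finrank [FiniteDimensional ℂ V]
    [LieModule.IsIrreducible ℂ Sl2 V]
    (hV : Module.finrank ℂ V = 2 ∨ Odd (Module.finrank ℂ V)) :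
    LieModule.IsActionDetermined ℂ Sl2 V := by
  intro g hg
  obtain ⟨n, v, b, B⟩ := isSl2Triple_standard.exists_isWeightBasis (V := V) Sl2.span_standard_eq_top
  have hdim : Module.finrank ℂ V = n + 1 := by
    rw [Module.finrank_eq_card_basis b, Fintype.card_fin]
  have hn : n = 1 ∨ Even n := by
    rw [hdim] at hV
    rcases hV with h | h
    · exact Or.inl (by omega)
    · exact Or.inr (by rw [Nat.odd_add_one, Nat.not_odd_iff_even] at h; exact h)
  -- Forced by `f v_k = v_(k+1)` and `h v_0 = n v_0`. For `n = 0` the quotient is the default `0`,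
  -- harmless since then `h v_0 = 0` gives `g h v_0 = 0`.
  let c : ℕ → ℂ := fun k => if k = 0 then g sl2H (v 0) / n else g sl2F (v (k - 1))
  let ψ : V →ₗ[ℂ] ℂ := b.constr ℂ fun k => c k
  have hψ : ∀ k ≤ n, ψ (v k) = c k := fun k hk => by
    have := b.constr_basis ℂ (fun k : Fin (n + 1) => c k) ⟨k, by omega⟩
    rwa [B.basis_apply] at this
  let g' : Sl2 →ₗ[ℂ] V →ₗ[ℂ] ℂ := g - (LieModule.action Sl2 V).compr₂ ψ
  have hg' : ∀ x w, g' x w = g x w - ψ ⁅x, w⁆ := fun _ _ => rfl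
  have hzero : g' = 0 := by
    refine B.eq_zero_of_normalised hn (fun x w hxw => ?_) (fun w => ?_) ?_
    · rw [hg', hg x w hxw, hxw, map_zero, sub_zero]
    · refine LinearMap.congr_fun (B.linearMap_eq_zero (φ := g' sl2F) fun k => ?_) w
      rw [hg', B.lie_f]
      by_cases hk : k < n
      · rw [hψ (k + 1) hk]
        exact sub_self _
      · have hz : v (k + 1) = 0 := B.eq_zero _ (by omega)
        rw [hz, map_zero, sub_zero]
        exact hg _ _ (by rw [B.lie_f, hz])
    · rw [hg', B.lie_h, map_smul, hψ 0 n.zero_le]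
      by_cases hn0 : n = 0
      · rw [hg _ _ (by rw [B.lie_h, hn0]; simp)]
        simp [hn0]
      · have : (n : ℂ) ≠ 0 := Nat.cast_ne_zero.2 hn0
        simp only [c, if_true, smul_eq_mul]
        field_simp
        simp
  exact ⟨ψ, fun x w => sub_eq_zero.1 (LinearMap.congr_fun (LinearMap.congr_fun hzero x) w)⟩

end OddDimension

theorem theorem6p4 (V : Type*) [AddCommGroup V] [Module ℂ V] [LieRingModule Sl2 V]
    [LieModule ℂ Sl2 V] (hV : LieModule.IsIrreducible ℂ Sl2 V) :
    IsZeroProductDetermined ℂ (LieModule.SemidirectProduct ℂ Sl2 V) ↔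
      FiniteDimensional ℂ V ∧ (Module.finrank ℂ V = 2 ∨ Odd (Module.finrank ℂ V)) := by
  constructor
  · intro h
    have hdet := LieModule.SemidirectProduct.isActionDetermined h
    have := hdet.finiteDimensional
    exact ⟨this, hdet.finrank_eq_two_or_odd⟩
  · rintro ⟨hfin, hdim⟩
    exact (LieModule.isActionDetermined_of_finrank hdim).isZeroProductDetermined
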